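/- Let $\widetilde V\subseteq\mathbb R^3$ be open, invariant under rotations about the $\tilde z$-axis, with $\Lambda=0\in\widetilde V$; write points as $(\tilde\rho\cos\varphi,\tilde\rho\sin\varphi,\tilde z)$ and put $V=\widetilde V\setminus\{\Lambda\}$. Let $g_{ab}$ be a smooth metric of signature $(-,+,+,+)$ on $\mathbb R\times V$ that is stationary (with timelike Killing field $\xi=\partial_t$) and axisymmetric. Put $\lambda=-\xi^a\xi_a$, $h_{ab}=\lambda g_{ab}+\xi_a\xi_b$ (the metric on the manifold $V$ of Killing trajectories), and let $\omega$ be a smooth axisymmetric twist potential on $V$, $\nabla_a\omega=\epsilon_{abcd}\xi^b\nabla^c\xi^d$. Suppose the spacetime is asymptotically flat: there is a smooth $\Omega$ on $\widetilde V$, positive on $V$, such that $\tilde h_{ab}=\Omega^2h_{ab}$ extends to a smooth Riemannian metric on $\widetilde V$, with derivative operator $\tilde D_a$ and Ricci tensor $\widetilde R_{ab}$, and such that $\Omega=0$, $\tilde D_a\Omega=0$, $\tilde D_a\tilde D_b\Omega=2\tilde h_{ab}$ at $\Lambda$; and suppose that $\tilde\phi=\phi/\sqrt\Omega$ extends smoothly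 to $\Lambda$, where $\phi=\frac{\lambda^2+\omega^2-1}{4\lambda}+i\frac{\omega}{2\lambda}$. Assume finally that $$\tilde h_{ab}\sim e^{2\kappa}\left(\tilde\rho^2e^{-2\beta}d\varphi^2+d\tilde\rho^2+d\tilde z^2\right)$$ with smooth axisymmetric functions $\kappa,\beta$ on $\widetilde V$, $\kappa(\Lambda)=0$. Let $C[\,\cdot\,]$ denote the totally symmetric trace-free part with respect to $\tilde h_{ab}$, and define the Geroch--Hansen tensors on $\widetilde V$ by $P=\tilde\phi$ and, for $n\ge1$, $$P_{a_1\ldots a_n}=C\left[\tilde D_{a_1}P_{a_2\ldots a_n}-\tfrac{(n-1)(2n-3)}2\widetilde R_{a_1a_2}P_{a_3\ldots a_n}\right]$$ (the second term is absent for $n=1$). On the meridian plane of angle $\varphi$, with Cartesian coordinates $(\tilde z,\tilde\rho)$ ($\tilde\rho$ of either sign, so that $(\tilde z,\tilde\rho)$ denotes the point $(\tilde\rho\cos\varphi,\tilde\rho\sin\varphi,\tilde z)$), put $\eta^a=(\partial/\partial\tilde z)^a-i(\partial/\partial\tilde\rho)^a$ and $f_n=\eta^{a_1}\cdots\eta^{a_n}P_{a_1\ldots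 a_n}$ for $n\ge0$. Then: 1. Each $f_n$ is a smooth function of $(\tilde z,\tilde\rho)$, and it is the same function for every $\varphi$. 2. For all $n\ge1$, on the whole part of the meridian plane in $\widetilde V$ (including the axis and $\Lambda$), $$f_n=\eta^a\tilde D_af_{n-1}-2(n-1)f_{n-1}\,\eta^a\tilde D_a\kappa-\tfrac{(n-1)(2n-3)}2\,\eta^a\eta^b\widetilde R_{ab}\,f_{n-2},$$ where $\eta^a\tilde D_aF=\partial F/\partial\tilde z-i\,\partial F/\partial\tilde\rho$ for functions $F$ of $(\tilde z,\tilde\rho)$ (the last term is absent for $n=1$). 3. For every $n\ge0$ there is exactly one $m_n\in\mathbb C$ (the $n$-th multipole moment) with $P_{a_1\ldots a_n}(\Lambda)=m_n\,C[z_{a_1}\cdots z_{a_n}]$ at $\Lambda$, where $z_a=(d\tilde z)_a$, and $m_n=f_n(\Lambda)$. -/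

import Mathlib

open scoped ContDiff

namespace GerochHansen

noncomputable section

/-! ### Tensor calculus in a coordinate chart -/

/-- Components of a covariant tensor of rank `n` at a point; indices range over `ι`, values in `F`. -/
abbrev Tensor (ι F : Type) (n : ℕ) : Type := (Fin n → ι) → F

/-- The `i`-th coordinate partial derivative. -/
def pderiv {ι F : Type} [Fintype ι] [DecidableEq ι] [NormedAddCommGroup F] [NormedSpace ℝ F]
    (i : ι) (f : (ι → ℝ) → F) (x : ι → ℝ) : F :=
  fderiv ℝ f x (Pi.single i 1)

/-- Christoffel symbols `Γ^k_{ij}` of the Levi-Civita connection of the metric `G`. -/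
def christoffel {ι : Type} [Fintype ι] [DecidableEq ι] (G : (ι → ℝ) → Matrix ι ι ℝ)
    (k i j : ι) (x : ι → ℝ) : ℝ :=
  (1 / 2) * ∑ l, (G x)⁻¹ k l *
    (pderiv i (fun y => G y l j) x + pderiv j (fun y => G y l i) x - pderiv l (fun y => G y i j) x)

/-- Covariant derivative; the new index comes first:
`(covDeriv G T)_{a₀ a₁ … aₙ} = D_{a₀} T_{a₁ … aₙ}`. -/
def covDeriv {ι F : Type} [Fintype ι] [DecidableEq ι] [NormedAddCommGroup F] [NormedSpace ℝ F]
    (G : (ι → ℝ) → Matrix ι ι ℝ) {n : ℕ} (T : (ι → ℝ) → Tensor ι F n) :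
    (ι → ℝ) → Tensor ι F (n + 1) :=
  fun x I => pderiv (I 0) (fun y => T y (Fin.tail I)) x -
    ∑ k : Fin n, ∑ j : ι,
      christoffel G j (I 0) (Fin.tail I k) x • T x (Function.update (Fin.tail I) k j)

/-- Ricci tensor of `G` (the sign for which round spheres have positive Ricci curvature). -/
def ricci {ι : Type} [Fintype ι] [DecidableEq ι] (G : (ι → ℝ) → Matrix ι ι ℝ)
    (x : ι → ℝ) (i j : ι) : ℝ :=
  ∑ k, (pderiv k (christoffel G k i j) x - pderiv j (christoffel G k i k) x) +
    ∑ k, ∑ l, (christoffel G k k l x * christoffel G l i j x -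
      christoffel G k j l x * christoffel G l i k x)

/-! ### The totally symmetric trace-free part -/

/-- `T_{(a₁ … aₙ)}`. -/
def symmetrize {ι : Type} {n : ℕ} (T : Tensor ι ℂ n) : Tensor ι ℂ n :=
  fun I => (n.factorial : ℂ)⁻¹ * ∑ σ : Equiv.Perm (Fin n), T (I ∘ σ)

/-- `T` is totally symmetric. -/
def IsSymmetric {ι : Type} {n : ℕ} (T : Tensor ι ℂ n) : Prop :=
  ∀ (σ : Equiv.Perm (Fin n)) (I : Fin n → ι), T (I ∘ σ) = T I

/-- All traces of `T` with respect to the metric `h` vanish. -/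
def IsTraceFree {ι : Type} [Fintype ι] [DecidableEq ι] (h : Matrix ι ι ℝ) {n : ℕ}
    (T : Tensor ι ℂ n) : Prop :=
  ∀ a b : Fin n, a ≠ b → ∀ I : Fin n → ι,
    ∑ i, ∑ j, ((h⁻¹ i j : ℝ) : ℂ) * T (Function.update (Function.update I a i) b j) = 0

/-- The span of all tensors with a metric factor, `h_{c_a c_b} q`, where `q` carries the
other indices only. -/
def traceTerms {ι : Type} (h : Matrix ι ι ℝ) (n : ℕ) : Submodule ℂ (Tensor ι ℂ n) :=
  Submodule.span ℂ {B | ∃ a b : Fin n, a ≠ b ∧ ∃ q : Tensor ι ℂ n,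
    (∀ I J : Fin n → ι, (∀ k, k ≠ a → k ≠ b → I k = J k) → q I = q J) ∧
    B = fun I => ((h (I a) (I b) : ℝ) : ℂ) * q I}

/-- `S` is the totally symmetric and trace-free part of `T`: it is symmetric, trace-free, and
arises from the symmetrization of `T` by subtracting terms with a metric factor. -/
def IsSTFPart {ι : Type} [Fintype ι] [DecidableEq ι] (h : Matrix ι ι ℝ) {n : ℕ}
    (T S : Tensor ι ℂ n) : Prop :=
  IsSymmetric S ∧ IsTraceFree h S ∧ symmetrize T - S ∈ traceTerms h n

/-- `C[T]`, the totally symmetric and trace-free part of `T`. For a positive definite `h` exactly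
one tensor satisfies `IsSTFPart h T`. -/
def stfPart {ι : Type} [Fintype ι] [DecidableEq ι] (h : Matrix ι ι ℝ) {n : ℕ}
    (T : Tensor ι ℂ n) : Tensor ι ℂ n :=
  Classical.epsilon (IsSTFPart h T)

/-! ### The Geroch–Hansen tensors -/

/-- The tensors `P, P_{a₁}, P_{a₁a₂}, …` generated from the metric `G` and the potential `P = φ`:
`P_{a₁…aₙ} = C[D_{a₁} P_{a₂…aₙ} - ((n-1)(2n-3)/2) R_{a₁a₂} P_{a₃…aₙ}]`. For `n = 1` the
coefficient vanishes; the last clause is the case of rank `n + 2`. -/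
def multipoleTensor {ι : Type} [Fintype ι] [DecidableEq ι] (G : (ι → ℝ) → Matrix ι ι ℝ)
    (φ : (ι → ℝ) → ℂ) : (n : ℕ) → (ι → ℝ) → Tensor ι ℂ n
  | 0 => fun x _ => φ x
  | 1 => fun x => stfPart (G x) (covDeriv G (multipoleTensor G φ 0) x)
  | n + 2 => fun x => stfPart (G x) fun I =>
      covDeriv G (multipoleTensor G φ (n + 1)) x I -
        (((n : ℂ) + 1) * (2 * n + 1) / 2) * (ricci G x (I 0) (I 1) : ℂ) *
          multipoleTensor G φ n x (Fin.tail (Fin.tail I))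

/-! ### Stationary spacetimes -/

/-- `ℝ × V`, with the time coordinate at index `0`. -/
def spacetimeRegion (V : Set (Fin 3 → ℝ)) : Set (Fin 4 → ℝ) := {p | Fin.tail p ∈ V}

/-- The vector field `ξ = ∂/∂t`. -/
def xi : Fin 4 → ℝ := Pi.single 0 1

/-- The signature `(-,+,+,+)`. -/
def IsLorentzian (g : Matrix (Fin 4) (Fin 4) ℝ) : Prop :=
  ∃ B : Matrix (Fin 4) (Fin 4) ℝ, IsUnit B.det ∧
    B.transpose * g * B = Matrix.diagonal ![-1, 1, 1, 1]

/-- The volume form `ε_{abcd}` of `g` for the coordinate orientation. -/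
def volumeForm (g : Matrix (Fin 4) (Fin 4) ℝ) (a b c d : Fin 4) : ℝ :=
  √|g.det| * Matrix.det (Matrix.of fun i j : Fin 4 => if ![a, b, c, d] i = j then (1 : ℝ) else 0)

/-- The one-form `ε_{abcd} ξ^b ∇^c ξ^d` of the metric `g`. -/
def twistForm (g : (Fin 4 → ℝ) → Matrix (Fin 4) (Fin 4) ℝ) (p : Fin 4 → ℝ) (a : Fin 4) : ℝ :=
  ∑ b, ∑ c, ∑ d, volumeForm (g p) a b c d * xi b *
    ∑ c', ∑ d', (g p)⁻¹ c c' * (g p)⁻¹ d d' *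
      covDeriv (n := 1) g (fun q I => (g q).mulVec xi (I 0)) p ![c', d']

/-- A stationary spacetime whose manifold of Killing trajectories is the open set `V ⊆ ℝ³`, in
coordinates `(t, x) ∈ ℝ × V` adapted to the timelike Killing field `ξ = ∂/∂t`, together with its
twist potential `ω`, `∇_a ω = ε_{abcd} ξ^b ∇^c ξ^d`. -/
structure StationarySpacetime (V : Set (Fin 3 → ℝ)) where
  g : (Fin 4 → ℝ) → Matrix (Fin 4) (Fin 4) ℝ
  smooth : ∀ a b, ContDiffOn ℝ ∞ (fun p => g p a b) (spacetimeRegion V)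
  symm : ∀ p ∈ spacetimeRegion V, (g p).IsSymm
  lorentzian : ∀ p ∈ spacetimeRegion V, IsLorentzian (g p)
  stationary : ∀ p ∈ spacetimeRegion V, ∀ t : ℝ, g (p + t • xi) = g p
  timelike : ∀ p ∈ spacetimeRegion V, dotProduct xi ((g p).mulVec xi) < 0
  omega : (Fin 3 → ℝ) → ℝ
  omega_smooth : ContDiffOn ℝ ∞ omega V
  twist : ∀ p ∈ spacetimeRegion V, ∀ a,
    pderiv a (fun q => omega (Fin.tail q)) p = twistForm g p a

namespace StationarySpacetime

variable {V : Set (Fin 3 → ℝ)} (M : StationarySpacetime V)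

/-- The metric over the point `x ∈ V` (it does not depend on `t`). -/
def gAt (x : Fin 3 → ℝ) : Matrix (Fin 4) (Fin 4) ℝ := M.g (Fin.cons 0 x)

/-- `λ = -ξ^a ξ_a`. -/
def lam (x : Fin 3 → ℝ) : ℝ := -dotProduct xi ((M.gAt x).mulVec xi)

/-- The metric `h_{ab} = λ g_{ab} + ξ_a ξ_b` on the manifold of trajectories. -/
def h (x : Fin 3 → ℝ) : Matrix (Fin 3) (Fin 3) ℝ :=
  Matrix.of fun i j => M.lam x * M.gAt x i.succ j.succ +
    (M.gAt x).mulVec xi i.succ * (M.gAt x).mulVec xi j.succ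

/-- The potential `φ = φ_M + i φ_J`, `φ_M = (λ² + ω² - 1)/(4λ)`, `φ_J = ω/(2λ)`. -/
def potential (x : Fin 3 → ℝ) : ℂ :=
  (((M.lam x ^ 2 + M.omega x ^ 2 - 1) / (4 * M.lam x) : ℝ) : ℂ) +
    Complex.I * ((M.omega x / (2 * M.lam x) : ℝ) : ℂ)

end StationarySpacetime

/-- Asymptotic flatness: a conformal completion of `V = U \ {Λ}` by the single point `Λ = 0`, and
the rescaled potential `φ̃ = φ / √Ω`, which extends smoothly to `Λ`. -/
structure ConformalCompletion (U : Set (Fin 3 → ℝ)) (M : StationarySpacetime (U \ {0})) where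
  isOpen : IsOpen U
  mem_zero : (0 : Fin 3 → ℝ) ∈ U
  Ω : (Fin 3 → ℝ) → ℝ
  Ω_smooth : ContDiffOn ℝ ∞ Ω U
  Ω_pos : ∀ x ∈ U \ {0}, 0 < Ω x
  /-- the rescaled metric `h̃ = Ω² h` -/
  hT : (Fin 3 → ℝ) → Matrix (Fin 3) (Fin 3) ℝ
  hT_smooth : ∀ i j, ContDiffOn ℝ ∞ (fun x => hT x i j) U
  hT_posDef : ∀ x ∈ U, (hT x).PosDef
  hT_eq : ∀ x ∈ U \ {0}, hT x = Ω x ^ 2 • M.h x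
  Ω_zero : Ω 0 = 0
  dΩ_zero : ∀ a, covDeriv (n := 0) hT (fun x _ => Ω x) 0 ![a] = 0
  hessΩ_zero : ∀ a b,
    covDeriv hT (covDeriv (n := 0) hT (fun x _ => Ω x)) 0 ![a, b] = 2 * hT 0 a b
  /-- the rescaled potential -/
  phiT : (Fin 3 → ℝ) → ℂ
  phiT_smooth : ContDiffOn ℝ ∞ phiT U
  phiT_eq : ∀ x ∈ U \ {0}, phiT x = M.potential x / ((√(Ω x) : ℝ) : ℂ)

/-! ### Axisymmetry -/

/-- Rotation of space about the third (`z̃`) axis. -/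
def rot (α : ℝ) : Matrix (Fin 3) (Fin 3) ℝ :=
  !![Real.cos α, -Real.sin α, 0; Real.sin α, Real.cos α, 0; 0, 0, 1]

/-- The same rotation acting on spacetime. -/
def rotST (α : ℝ) : Matrix (Fin 4) (Fin 4) ℝ :=
  !![1, 0, 0, 0; 0, Real.cos α, -Real.sin α, 0; 0, Real.sin α, Real.cos α, 0; 0, 0, 0, 1]

/-- The distance `ρ̃` from the axis, for `x = (ρ̃ cos φ, ρ̃ sin φ, z̃)`. -/
def rho (x : Fin 3 → ℝ) : ℝ := √(x 0 ^ 2 + x 1 ^ 2)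

/-- The one-form `dρ̃` (off the axis). -/
def dRho (x : Fin 3 → ℝ) : Fin 3 → ℝ := ![x 0 / rho x, x 1 / rho x, 0]

/-- The one-form `dφ` (off the axis). -/
def dPhi (x : Fin 3 → ℝ) : Fin 3 → ℝ := ![-x 1 / rho x ^ 2, x 0 / rho x ^ 2, 0]

/-- The one-form `dz̃`. -/
def dZ : Fin 3 → ℝ := ![0, 0, 1]

/-- The spacetime is axisymmetric, and its rescaled metric is
`e^{2κ} (ρ̃² e^{-2β} dφ² + dρ̃² + dz̃²)` with axisymmetric smooth `κ`, `β` and `κ(Λ) = 0`. The form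
of the metric is required off the axis; on the axis it holds by continuity. -/
structure IsAxisymmetric {U : Set (Fin 3 → ℝ)} {M : StationarySpacetime (U \ {0})}
    (A : ConformalCompletion U M) (κ β : (Fin 3 → ℝ) → ℝ) : Prop where
  domain : ∀ α, ∀ x ∈ U, (rot α).mulVec x ∈ U
  metric : ∀ α, ∀ p ∈ spacetimeRegion (U \ {0}),
    (rotST α).transpose * M.g ((rotST α).mulVec p) * rotST α = M.g p
  omega : ∀ α, ∀ x ∈ U \ {0}, M.omega ((rot α).mulVec x) = M.omega x
  κ_smooth : ContDiffOn ℝ ∞ κ U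
  κ_inv : ∀ α, ∀ x ∈ U, κ ((rot α).mulVec x) = κ x
  κ_zero : κ 0 = 0
  β_smooth : ContDiffOn ℝ ∞ β U
  β_inv : ∀ α, ∀ x ∈ U, β ((rot α).mulVec x) = β x
  form : ∀ x ∈ U, rho x ≠ 0 → A.hT x = Real.exp (2 * κ x) •
    ((rho x ^ 2 * Real.exp (-2 * β x)) • Matrix.vecMulVec (dPhi x) (dPhi x) +
      Matrix.vecMulVec (dRho x) (dRho x) + Matrix.vecMulVec dZ dZ)

/-! ### The scalars -/

/-- The point of the meridian plane at angle `α` with coordinates `q = (z̃, ρ̃)`; as usual `ρ̃` may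
also be negative. -/
def meridian (α : ℝ) (q : ℝ × ℝ) : Fin 3 → ℝ := ![q.2 * Real.cos α, q.2 * Real.sin α, q.1]

/-- The part of the meridian plane at angle `α` that lies in `U`. -/
def meridianDomain (U : Set (Fin 3 → ℝ)) (α : ℝ) : Set (ℝ × ℝ) := {q | meridian α q ∈ U}

/-- Cartesian components of `η = ∂/∂z̃ - i ∂/∂ρ̃` along the meridian plane at angle `α`. -/
def eta (α : ℝ) : Fin 3 → ℂ := ![-Complex.I * Real.cos α, -Complex.I * Real.sin α, 1]

/-- `v^{a₁} ⋯ v^{aₙ} T_{a₁…aₙ}`. -/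
def contract (v : Fin 3 → ℂ) {n : ℕ} (T : Tensor (Fin 3) ℂ n) : ℂ :=
  ∑ I : Fin n → Fin 3, (∏ k, v (I k)) * T I

/-- `η^a D̃_a F = ∂F/∂z̃ - i ∂F/∂ρ̃` for a function `F` of `(z̃, ρ̃)`. -/
def etaD (F : ℝ × ℝ → ℂ) (q : ℝ × ℝ) : ℂ :=
  fderiv ℝ F q (1, 0) - Complex.I * fderiv ℝ F q (0, 1)

namespace ConformalCompletion

variable {U : Set (Fin 3 → ℝ)} {M : StationarySpacetime (U \ {0})} (A : ConformalCompletion U M)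

/-- The Geroch–Hansen tensors `P_{a₁…aₙ}` of the spacetime. -/
def P (n : ℕ) : (Fin 3 → ℝ) → Tensor (Fin 3) ℂ n := multipoleTensor A.hT A.phiT n

/-- `fₙ = η^{a₁} ⋯ η^{aₙ} P_{a₁…aₙ}` as a function of `(z̃, ρ̃)` on the meridian plane at angle
`α`. -/
def f (α : ℝ) (n : ℕ) (q : ℝ × ℝ) : ℂ := contract (eta α) (A.P n (meridian α q))

/-- `η^a η^b R̃_{ab}` on the meridian plane at angle `α`. -/
def etaRicci (α : ℝ) (q : ℝ × ℝ) : ℂ :=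
  contract (eta α) (n := 2) fun I => (ricci A.hT (meridian α q) (I 0) (I 1) : ℂ)

/-- `m` is the `n`-th multipole moment: `P_{a₁…aₙ}(Λ) = m C[z_{a₁} ⋯ z_{aₙ}]` with `z = dz̃`. -/
def IsMoment (n : ℕ) (m : ℂ) : Prop :=
  A.P n 0 = m • stfPart (A.hT 0) fun I : Fin n → Fin 3 => ∏ k, (dZ (I k) : ℂ)

end ConformalCompletion

end

end GerochHansen

/-!
Symmetrization and terms with a factor `h̃_{ab}` are invisible to the contraction with `η ⋯ η`,
because `η` is null for `h̃`; hence `C` may be dropped in `fₙ`. The form of `h̃` makes `η` geodesic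
up to scale, `Γ^k_{ij} η^i η^j = 2 (η^a ∂_a κ) η^k`, so that contracting `D̃ P_{a₁…aₙ}` with `η ⋯ η`
gives `η^a ∂_a fₙ - 2 n fₙ η^a ∂_a κ`, which is the recursion. Both facts are computed off the axis
and extend to it by continuity. For `h̃ = Ω² h` the `zz`-components show that `Ω` is invariant under
rotations; so is `φ̃`, and since rotations are isometries of `h̃` the recursion produces the same
functions on all meridian planes.

Smoothness of `C[T]` follows from a smooth orthonormal frame (the square root of `h̃`), in which `C`
is one fixed linear map: the symmetrized orthogonal projection away from the trace terms.

At `Λ` the metric is Euclidean, and a symmetric trace-free tensor is determined by its contractions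
with the null vectors `η` of all meridian planes: differentiating in the angle shows that its
contraction with any vector has the same vanishing property, and induction on the rank applies.
-/

namespace GerochHansen

section MultiIndex

variable {ι : Type*} [Fintype ι] {n : ℕ}

lemma sum_comp_perm {M : Type*} [AddCommMonoid M] (σ : Equiv.Perm (Fin n))
    (F : (Fin n → ι) → M) : ∑ I : Fin n → ι, F (I ∘ σ) = ∑ I, F I :=
  (Equiv.arrowCongr σ.symm (Equiv.refl ι)).sum_comp F

lemma sum_sum_update_apply {M : Type*} [AddCommMonoid M] (a : Fin n)
    (F : (Fin n → ι) → ι → M) :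
    ∑ I, ∑ i, F (Function.update I a i) (I a) = ∑ I, ∑ i, F I i := by
  let e : ((Fin n → ι) × ι) ≃ ((Fin n → ι) × ι) :=
    { toFun := fun p => (Function.update p.1 a p.2, p.1 a)
      invFun := fun p => (Function.update p.1 a p.2, p.1 a)
      left_inv := fun p => by simp
      right_inv := fun p => by simp }
  calc ∑ I, ∑ i, F (Function.update I a i) (I a) = ∑ p, F (e p).1 (e p).2 :=
        (Fintype.sum_prod_type' fun I i => F (Function.update I a i) (I a)).symm
    _ = ∑ p : (Fin n → ι) × ι, F p.1 p.2 := e.sum_comp fun p => F p.1 p.2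
    _ = ∑ I, ∑ i, F I i := Fintype.sum_prod_type' F

lemma sum_sum_update {M : Type*} [AddCommMonoid M] (a : Fin n) (F : (Fin n → ι) → M) :
    ∑ I, ∑ i, F (Function.update I a i) = Fintype.card ι • ∑ I, F I := by
  rw [sum_sum_update_apply a fun I _ => F I]
  simp only [Finset.sum_const, Finset.card_univ, Finset.smul_sum]

lemma sum_eq_inv_card_mul_sum_update_update (a b : Fin n) (F : (Fin n → ι) → ℂ) :
    ∑ J, F J = ((Fintype.card ι : ℂ) * Fintype.card ι)⁻¹ *
      ∑ J, ∑ i, ∑ j, F (Function.update (Function.update J a i) b j) := by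
  rcases isEmpty_or_nonempty ι with hι | hι
  · have : IsEmpty (Fin n → ι) := ⟨fun I => hι.elim (I a)⟩
    simp
  have hcard : (Fintype.card ι : ℂ) * Fintype.card ι ≠ 0 := by simp
  rw [eq_inv_mul_iff_mul_eq₀ hcard, sum_sum_update a fun J => ∑ j, F (Function.update J b j),
    sum_sum_update, nsmul_eq_mul, nsmul_eq_mul, mul_assoc]

lemma apply_update_update_of_forall_eq {ι M : Type*} {n : ℕ} {a b : Fin n} {r : (Fin n → ι) → M}
    (hr : ∀ I J, (∀ k, k ≠ a → k ≠ b → I k = J k) → r I = r J) (J : Fin n → ι) (i j : ι) :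
    r (Function.update (Function.update J a i) b j) = r J :=
  hr _ _ fun k hka hkb => by rw [Function.update_of_ne hkb, Function.update_of_ne hka]

lemma sum_mul_eq_of_forall_eq {a b : Fin n} (hab : a ≠ b) (F : ι → ι → ℂ) {r : (Fin n → ι) → ℂ}
    (hr : ∀ I J, (∀ k, k ≠ a → k ≠ b → I k = J k) → r I = r J) :
    ∑ J, F (J a) (J b) * r J =
      (∑ i, ∑ j, F i j) * (((Fintype.card ι : ℂ) * Fintype.card ι)⁻¹ * ∑ J, r J) := by
  rw [sum_eq_inv_card_mul_sum_update_update a b, mul_left_comm]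
  simp only [apply_update_update_of_forall_eq hr, Function.update_self, Function.update_of_ne hab,
    ← Finset.sum_mul, Finset.mul_sum]

lemma sum_eq_sum_update_update {M : Type*} [AddCommMonoid M] {a b : Fin n} (hab : a ≠ b)
    (I : Fin n → ι) {F : (Fin n → ι) → M}
    (hF : ∀ J, (¬ ∀ k, k ≠ a → k ≠ b → J k = I k) → F J = 0) :
    ∑ J, F J = ∑ i, ∑ j, F (Function.update (Function.update I a i) b j) := by
  rw [← Fintype.sum_prod_type' fun i j => F (Function.update (Function.update I a i) b j)]
  symm
  refine Fintype.sum_of_injective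
    (fun p : ι × ι => Function.update (Function.update I a p.1) b p.2) ?_ _ _ ?_ fun _ => rfl
  · intro p p' hp
    have ha := congrFun hp a
    have hb := congrFun hp b
    simp only [Function.update_of_ne hab, Function.update_self] at ha hb
    exact Prod.ext ha hb
  · intro J hJ
    refine hF J fun hagree => hJ ⟨(J a, J b), funext fun k => ?_⟩
    rcases eq_or_ne k b with rfl | hkb
    · simp
    rcases eq_or_ne k a with rfl | hka
    · simp [hab]
    · simp [hka, hkb, hagree k hka hkb]

end MultiIndex

/-! ### Pullbacks and traces -/

/-- The matrix of the `n`-fold tensor power of the linear map with matrix `E`. -/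
def tensorPower {ι : Type} (E : Matrix ι ι ℝ) (n : ℕ) : Matrix (Fin n → ι) (Fin n → ι) ℂ :=
  Matrix.of fun J I => ∏ k, (E (J k) (I k) : ℂ)

section TensorPower

variable {ι : Type} {n : ℕ}

lemma tensorPower_apply (E : Matrix ι ι ℝ) (J I : Fin n → ι) :
    tensorPower E n J I = ∏ k, (E (J k) (I k) : ℂ) :=
  rfl

lemma transpose_tensorPower (E : Matrix ι ι ℝ) :
    (tensorPower E n).transpose = tensorPower E.transpose n :=
  rfl

lemma tensorPower_one [DecidableEq ι] : tensorPower (1 : Matrix ι ι ℝ) n = 1 := by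
  ext J I
  rw [tensorPower_apply]
  rcases eq_or_ne J I with rfl | hJI
  · simp
  · obtain ⟨k, hk⟩ := Function.ne_iff.1 hJI
    rw [Matrix.one_apply_ne hJI, Finset.prod_eq_zero (Finset.mem_univ k)]
    simp [Matrix.one_apply_ne hk]

lemma tensorPower_mul [Fintype ι] (E F : Matrix ι ι ℝ) :
    tensorPower (E * F) n = tensorPower E n * tensorPower F n := by
  ext J I
  simp only [tensorPower_apply, Matrix.mul_apply, Complex.ofReal_sum, Complex.ofReal_mul,
    Finset.prod_univ_sum, Fintype.piFinset_univ, Finset.prod_mul_distrib]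

end TensorPower

/-- The pullback `(E^* T)_{i₁…iₙ} = E^{j₁}_{i₁} ⋯ E^{jₙ}_{iₙ} T_{j₁…jₙ}` of covariant tensors. -/
noncomputable def pullback {ι : Type} [Fintype ι] (E : Matrix ι ι ℝ) {n : ℕ} :
    Tensor ι ℂ n →ₗ[ℂ] Tensor ι ℂ n :=
  (tensorPower E n).vecMulLinear

/-- Symmetrization as a linear map. -/
noncomputable def symmetrizeLinear (ι : Type) (n : ℕ) : Tensor ι ℂ n →ₗ[ℂ] Tensor ι ℂ n :=
  (n.factorial : ℂ)⁻¹ • ∑ σ : Equiv.Perm (Fin n), LinearMap.funLeft ℂ ℂ fun I => I ∘ σ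

section Symmetrize

variable {ι : Type} {n : ℕ}

lemma symmetrizeLinear_apply (T : Tensor ι ℂ n) : symmetrizeLinear ι n T = symmetrize T := by
  funext I
  simp [symmetrizeLinear, symmetrize, LinearMap.funLeft_apply]

lemma isSymmetric_symmetrize (T : Tensor ι ℂ n) : IsSymmetric (symmetrize T) := fun σ I =>
  congrArg ((n.factorial : ℂ)⁻¹ * ·) (Equiv.sum_comp (Equiv.mulLeft σ) fun τ => T (I ∘ τ))

lemma IsSymmetric.symmetrize_eq {T : Tensor ι ℂ n} (hT : IsSymmetric T) : symmetrize T = T := by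
  funext I
  have hcard : (n.factorial : ℂ) ≠ 0 := by exact_mod_cast n.factorial_ne_zero
  simp [symmetrize, hT _ I, Fintype.card_perm, hcard]

lemma IsSymmetric.smul {T : Tensor ι ℂ n} (hT : IsSymmetric T) (c : ℂ) : IsSymmetric (c • T) :=
  fun σ I => congrArg (c * ·) (hT σ I)

lemma IsSymmetric.sub {S T : Tensor ι ℂ n} (hS : IsSymmetric S) (hT : IsSymmetric T) :
    IsSymmetric (S - T) :=
  fun σ I => congrArg₂ (· - ·) (hS σ I) (hT σ I)

lemma comp_perm_mem_traceTerms {h : Matrix ι ι ℝ} {T : Tensor ι ℂ n} (hT : T ∈ traceTerms h n)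
    (σ : Equiv.Perm (Fin n)) : (fun I => T (I ∘ σ)) ∈ traceTerms h n := by
  induction hT using Submodule.span_induction with
  | zero => exact Submodule.zero_mem _
  | add S T _ _ hS hT => exact Submodule.add_mem _ hS hT
  | smul c T _ hT => exact Submodule.smul_mem _ c hT
  | mem T hT =>
    obtain ⟨a, b, hab, q, hq, rfl⟩ := hT
    refine Submodule.subset_span ⟨σ a, σ b, σ.injective.ne hab, fun I => q (I ∘ σ),
      fun I J hIJ => hq _ _ fun k hka hkb => ?_, rfl⟩
    exact hIJ _ (σ.injective.ne hka) (σ.injective.ne hkb)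

lemma symmetrize_mem_traceTerms {h : Matrix ι ι ℝ} {T : Tensor ι ℂ n}
    (hT : T ∈ traceTerms h n) : symmetrize T ∈ traceTerms h n := by
  rw [← symmetrizeLinear_apply, symmetrizeLinear, LinearMap.smul_apply, LinearMap.sum_apply]
  exact Submodule.smul_mem _ _ (Submodule.sum_mem _ fun σ _ => comp_perm_mem_traceTerms hT σ)

lemma dotProduct_symmetrize [Fintype ι] (B T : Tensor ι ℂ n) :
    B ⬝ᵥ symmetrize T = symmetrize B ⬝ᵥ T := by
  have hpair (σ : Equiv.Perm (Fin n)) : ∑ I, B I * T (I ∘ σ) = ∑ I, B (I ∘ σ.symm) * T I := by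
    rw [← sum_comp_perm σ.symm]
    simp [Function.comp_assoc]
  simp only [dotProduct, symmetrize, mul_assoc, Finset.sum_mul, Finset.mul_sum, mul_left_comm (B _)]
  rw [Finset.sum_comm, Finset.sum_comm (s := Finset.univ (α := Fin n → ι))]
  simp only [← Finset.mul_sum, hpair]
  exact congrArg _ (Equiv.sum_comp (Equiv.inv (Equiv.Perm (Fin n))) fun τ => ∑ I, B (I ∘ τ) * T I)

end Symmetrize

section Pullback

variable {ι : Type} [Fintype ι] {n : ℕ}

lemma pullback_apply (E : Matrix ι ι ℝ) (T : Tensor ι ℂ n) (I : Fin n → ι) :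
    pullback E T I = ∑ J, T J * ∏ k, (E (J k) (I k) : ℂ) :=
  rfl

lemma pullback_mul (E F : Matrix ι ι ℝ) (T : Tensor ι ℂ n) :
    pullback (E * F) T = pullback F (pullback E T) := by
  simp only [pullback, Matrix.vecMulLinear_apply, Matrix.vecMul_vecMul, tensorPower_mul]

lemma pullback_one [DecidableEq ι] (T : Tensor ι ℂ n) : pullback (1 : Matrix ι ι ℝ) T = T := by
  simp only [pullback, Matrix.vecMulLinear_apply, tensorPower_one, Matrix.vecMul_one]

lemma dotProduct_pullback (E : Matrix ι ι ℝ) (B T : Tensor ι ℂ n) :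
    B ⬝ᵥ pullback E T = pullback E.transpose B ⬝ᵥ T := by
  rw [pullback, pullback, Matrix.vecMulLinear_apply, Matrix.vecMulLinear_apply,
    ← transpose_tensorPower, Matrix.vecMul_transpose, dotProduct_comm, ← Matrix.dotProduct_mulVec,
    dotProduct_comm]

lemma pullback_comp_perm (E : Matrix ι ι ℝ) (T : Tensor ι ℂ n) (σ : Equiv.Perm (Fin n))
    (I : Fin n → ι) : pullback E T (I ∘ σ) = pullback E (fun J => T (J ∘ σ)) I := by
  simp only [pullback_apply]
  rw [← sum_comp_perm σ]
  exact Finset.sum_congr rfl fun J _ =>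
    congrArg _ (Equiv.prod_comp σ fun k => (E (J k) (I k) : ℂ))

lemma pullback_symmetrize (E : Matrix ι ι ℝ) (T : Tensor ι ℂ n) :
    pullback E (symmetrize T) = symmetrize (pullback E T) := by
  rw [← symmetrizeLinear_apply, symmetrizeLinear, LinearMap.smul_apply, LinearMap.sum_apply,
    map_smul, map_sum]
  funext I
  simp only [Pi.smul_apply, Finset.sum_apply, symmetrize, pullback_comp_perm]
  rfl

lemma IsSymmetric.pullback {T : Tensor ι ℂ n} (hT : IsSymmetric T) (E : Matrix ι ι ℝ) :
    IsSymmetric (pullback E T) := fun σ I => by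
  rw [pullback_comp_perm, funext fun J => hT σ J]

lemma pullback_mem_traceTerms {h E : Matrix ι ι ℝ} {T : Tensor ι ℂ n}
    (hT : T ∈ traceTerms h n) : pullback E T ∈ traceTerms (E.transpose * h * E) n := by
  induction hT using Submodule.span_induction with
  | zero => rw [map_zero]; exact Submodule.zero_mem _
  | add S T _ _ hS hT => rw [map_add]; exact Submodule.add_mem _ hS hT
  | smul c T _ hT => rw [map_smul]; exact Submodule.smul_mem _ _ hT
  | mem T hT =>
    obtain ⟨a, b, hab, q, hq, rfl⟩ := hT
    let s : Finset (Fin n) := (Finset.univ.erase a).erase b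
    let r (I J : Fin n → ι) : ℂ := q J * ∏ k ∈ s, (E (J k) (I k) : ℂ)
    have hs {k : Fin n} (hk : k ∈ s) : k ≠ a ∧ k ≠ b :=
      ⟨Finset.ne_of_mem_erase (Finset.mem_of_mem_erase hk), Finset.ne_of_mem_erase hk⟩
    have hr (I J J' : Fin n → ι) (hJ : ∀ k, k ≠ a → k ≠ b → J k = J' k) : r I J = r I J' :=
      congrArg₂ (· * ·) (hq J J' hJ) (Finset.prod_congr rfl fun k hk => by
        rw [hJ k (hs hk).1 (hs hk).2])
    refine Submodule.subset_span ⟨a, b, hab,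
      fun I => ((Fintype.card ι : ℂ) * Fintype.card ι)⁻¹ * ∑ J, r I J, fun I I' hI => ?_, ?_⟩
    · refine congrArg _ (Finset.sum_congr rfl fun J _ => congrArg (q J * ·)
        (Finset.prod_congr rfl fun k hk => by rw [hI k (hs hk).1 (hs hk).2]))
    · funext I
      have hsplit (J : Fin n → ι) : (h (J a) (J b) : ℂ) * q J * ∏ k, (E (J k) (I k) : ℂ) =
          (E (J a) (I a) * h (J a) (J b) * E (J b) (I b)) * r I J := by
        rw [← Finset.mul_prod_erase _ _ (Finset.mem_univ a),
          ← Finset.mul_prod_erase _ _ (Finset.mem_erase.2 ⟨hab.symm, Finset.mem_univ b⟩)]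
        simp only [r, s]
        ring
      simp only [pullback_apply, hsplit]
      rw [sum_mul_eq_of_forall_eq hab (fun i j => (E i (I a) * h i j * E j (I b) : ℂ)) (hr I),
        Finset.sum_comm]
      simp [Matrix.mul_apply, Finset.sum_mul]

variable [DecidableEq ι]

lemma isTraceFree_iff_dotProduct_eq_zero {h : Matrix ι ι ℝ} {T : Tensor ι ℂ n} :
    IsTraceFree h T ↔ ∀ B ∈ traceTerms h⁻¹ n, B ⬝ᵥ T = 0 := by
  constructor
  · intro hT B hB
    induction hB using Submodule.span_induction with
    | zero => exact zero_dotProduct T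
    | add S B _ _ hS hB => rw [add_dotProduct, hS, hB, add_zero]
    | smul c B _ hB => rw [smul_dotProduct, hB, smul_zero]
    | mem B hB =>
      obtain ⟨a, b, hab, q, hq, rfl⟩ := hB
      rw [dotProduct, sum_eq_inv_card_mul_sum_update_update a b]
      simp only [apply_update_update_of_forall_eq hq, Function.update_of_ne hab,
        Function.update_self, mul_right_comm _ (q _), ← Finset.sum_mul, hT a b hab, zero_mul,
        Finset.sum_const_zero, mul_zero]
  · intro hT a b hab I
    let q : Tensor ι ℂ n := fun J => if ∀ k, k ≠ a → k ≠ b → J k = I k then 1 else 0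
    have hq (J J' : Fin n → ι) (hJ : ∀ k, k ≠ a → k ≠ b → J k = J' k) : q J = q J' := by
      have hiff : (∀ k, k ≠ a → k ≠ b → J k = I k) ↔ ∀ k, k ≠ a → k ≠ b → J' k = I k :=
        forall₃_congr fun k hka hkb => by rw [hJ k hka hkb]
      simp only [q, hiff]
    have horth := hT _ (Submodule.subset_span ⟨a, b, hab, q, hq, rfl⟩)
    rw [dotProduct, sum_eq_sum_update_update hab I fun J hJ => by simp only [q, if_neg hJ]; ring]
      at horth
    have hqI (i j : ι) : q (Function.update (Function.update I a i) b j) = 1 :=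
      (apply_update_update_of_forall_eq hq I i j).trans (if_pos fun _ _ _ => rfl)
    simpa only [hqI, mul_one, Function.update_of_ne hab, Function.update_self] using horth

lemma IsTraceFree.pullback {h E : Matrix ι ι ℝ} (hE : IsUnit E.det) {T : Tensor ι ℂ n}
    (hT : IsTraceFree h T) : IsTraceFree (E.transpose * h * E) (pullback E T) := by
  have hET : IsUnit E.transpose.det := by rwa [Matrix.det_transpose]
  have hinv : E.transpose.transpose * (E.transpose * h * E)⁻¹ * E.transpose = h⁻¹ := by
    rw [Matrix.transpose_transpose, Matrix.mul_inv_rev, Matrix.mul_inv_rev,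
      Matrix.mul_nonsing_inv_cancel_left _ _ hE, Matrix.nonsing_inv_mul_cancel_right _ _ hET]
  refine isTraceFree_iff_dotProduct_eq_zero.2 fun B hB => ?_
  rw [dotProduct_pullback]
  exact isTraceFree_iff_dotProduct_eq_zero.1 hT _ (hinv ▸ pullback_mem_traceTerms hB)

lemma IsTraceFree.symmetrize {h : Matrix ι ι ℝ} {T : Tensor ι ℂ n} (hT : IsTraceFree h T) :
    IsTraceFree h (symmetrize T) :=
  isTraceFree_iff_dotProduct_eq_zero.2 fun B hB => by
    rw [dotProduct_symmetrize]
    exact isTraceFree_iff_dotProduct_eq_zero.1 hT _ (symmetrize_mem_traceTerms hB)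

lemma IsSTFPart.pullback {h E : Matrix ι ι ℝ} (hE : IsUnit E.det) {T S : Tensor ι ℂ n}
    (hS : IsSTFPart h T S) : IsSTFPart (E.transpose * h * E) (pullback E T) (pullback E S) := by
  refine ⟨hS.1.pullback E, hS.2.1.pullback hE, ?_⟩
  rw [← pullback_symmetrize, ← map_sub]
  exact pullback_mem_traceTerms hS.2.2

end Pullback

/-! ### Existence and uniqueness of the symmetric trace-free part -/

lemma star_mem_traceTerms {ι : Type} {n : ℕ} {h : Matrix ι ι ℝ}
    {T : Tensor ι ℂ n} (hT : T ∈ traceTerms h n) : star T ∈ traceTerms h n := by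
  induction hT using Submodule.span_induction with
  | zero => rw [star_zero]; exact Submodule.zero_mem _
  | add S T _ _ hS hT => rw [star_add]; exact Submodule.add_mem _ hS hT
  | smul c T _ hT => rw [star_smul]; exact Submodule.smul_mem _ _ hT
  | mem T hT =>
    obtain ⟨a, b, hab, q, hq, rfl⟩ := hT
    refine Submodule.subset_span ⟨a, b, hab, star q, fun I J hIJ => congrArg star (hq I J hIJ), ?_⟩
    funext I
    simp [mul_comm]

section Euclidean

variable (ι : Type) [Fintype ι] [DecidableEq ι] (n : ℕ)

/-- The span of the tensors with a factor `δ_{ab}` as a subspace of the Hermitian space of all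
tensors; its orthogonal complement consists of the trace-free tensors. -/
noncomputable def euclideanTraceTerms : Submodule ℂ (EuclideanSpace ℂ (Fin n → ι)) :=
  (traceTerms (1 : Matrix ι ι ℝ) n).comap (WithLp.linearEquiv 2 ℂ (Tensor ι ℂ n)).toLinearMap

/-- The orthogonal projection of a tensor onto the trace-free ones for the Euclidean metric. -/
noncomputable def euclideanTraceFreePart : Tensor ι ℂ n →ₗ[ℂ] Tensor ι ℂ n :=
  (WithLp.linearEquiv 2 ℂ (Tensor ι ℂ n)).conj
    ((euclideanTraceTerms ι n)ᗮ.starProjection : _ →ₗ[ℂ] _)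

/-- `C[·]` for the Euclidean metric, as a linear map. -/
noncomputable def euclideanSTFPart : Tensor ι ℂ n →ₗ[ℂ] Tensor ι ℂ n :=
  symmetrizeLinear ι n ∘ₗ euclideanTraceFreePart ι n

variable {ι n}

lemma isTraceFree_of_mem_orthogonal {T : EuclideanSpace ℂ (Fin n → ι)}
    (hT : T ∈ (euclideanTraceTerms ι n)ᗮ) : IsTraceFree (1 : Matrix ι ι ℝ) T.ofLp := by
  refine isTraceFree_iff_dotProduct_eq_zero.2 fun B hB => ?_
  rw [inv_one] at hB
  have horth := hT (WithLp.toLp 2 (star B)) (star_mem_traceTerms hB)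
  rwa [EuclideanSpace.inner_toLp_toLp, star_star, dotProduct_comm] at horth

open scoped ComplexOrder in
lemma eq_zero_of_isTraceFree_of_mem_traceTerms {T : Tensor ι ℂ n}
    (hfree : IsTraceFree (1 : Matrix ι ι ℝ) T) (hmem : T ∈ traceTerms (1 : Matrix ι ι ℝ) n) :
    T = 0 := by
  have horth := isTraceFree_iff_dotProduct_eq_zero.1 hfree (star T)
    (by rw [inv_one]; exact star_mem_traceTerms hmem)
  exact dotProduct_star_self_eq_zero.1 horth

lemma isSTFPart_euclideanSTFPart (T : Tensor ι ℂ n) : IsSTFPart 1 T (euclideanSTFPart ι n T) := by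
  set S := (euclideanTraceTerms ι n)ᗮ.starProjection (WithLp.toLp 2 T)
  have hS : euclideanSTFPart ι n T = symmetrize S.ofLp := symmetrizeLinear_apply _
  rw [hS]
  refine ⟨isSymmetric_symmetrize _, IsTraceFree.symmetrize
    (isTraceFree_of_mem_orthogonal (Submodule.starProjection_apply_mem _ _)), ?_⟩
  rw [← symmetrizeLinear_apply, ← symmetrizeLinear_apply, ← map_sub, symmetrizeLinear_apply]
  refine symmetrize_mem_traceTerms (?_ : WithLp.toLp 2 T - S ∈ euclideanTraceTerms ι n)
  rw [← Submodule.orthogonal_orthogonal (euclideanTraceTerms ι n)]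
  exact Submodule.sub_starProjection_mem_orthogonal _

lemma IsTraceFree.smul {h : Matrix ι ι ℝ} {T : Tensor ι ℂ n} (hT : IsTraceFree h T) (c : ℂ) :
    IsTraceFree h (c • T) :=
  isTraceFree_iff_dotProduct_eq_zero.2 fun B hB => by
    rw [dotProduct_smul, isTraceFree_iff_dotProduct_eq_zero.1 hT B hB, smul_zero]

lemma IsTraceFree.of_smul {h : Matrix ι ι ℝ} {T : Tensor ι ℂ n} {c : ℝ}
    (hT : IsTraceFree (c • h) T) (hc : c ≠ 0) (hh : IsUnit h.det) : IsTraceFree h T := by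
  intro a b hab I
  have htrace := hT a b hab I
  let := invertibleOfNonzero hc
  simpa [Matrix.inv_smul h c hh, mul_assoc, ← Finset.mul_sum, hc] using htrace

lemma IsTraceFree.sub {h : Matrix ι ι ℝ} {S T : Tensor ι ℂ n} (hS : IsTraceFree h S)
    (hT : IsTraceFree h T) : IsTraceFree h (S - T) :=
  isTraceFree_iff_dotProduct_eq_zero.2 fun B hB => by
    rw [dotProduct_sub, isTraceFree_iff_dotProduct_eq_zero.1 hS B hB,
      isTraceFree_iff_dotProduct_eq_zero.1 hT B hB, sub_zero]

lemma IsSTFPart.unique_one {T S S' : Tensor ι ℂ n} (hS : IsSTFPart 1 T S)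
    (hS' : IsSTFPart 1 T S') : S = S' := by
  refine sub_eq_zero.1 (eq_zero_of_isTraceFree_of_mem_traceTerms (hS.2.1.sub hS'.2.1) ?_)
  rw [← sub_sub_sub_cancel_left _ _ (symmetrize T)]
  exact Submodule.sub_mem _ hS'.2.2 hS.2.2

end Euclidean

/-- `E` is the matrix of an orthonormal coframe of the metric `h`. -/
structure IsFrame {ι : Type} [Fintype ι] [DecidableEq ι] (h E : Matrix ι ι ℝ) : Prop where
  isUnit_det : IsUnit E.det
  transpose_mul_self : E.transpose * E = h

section Frame

variable {ι : Type} [Fintype ι] [DecidableEq ι] {n : ℕ} {h E : Matrix ι ι ℝ}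

lemma isFrame_of_posDef (hh : h.PosDef) (hE : E.transpose * E = h) : IsFrame h E := by
  refine ⟨?_, hE⟩
  have hdet := (Matrix.isUnit_iff_isUnit_det _).1 hh.isUnit
  rw [← hE, Matrix.det_mul] at hdet
  exact isUnit_of_mul_isUnit_right hdet

open scoped MatrixOrder in
lemma exists_isFrame (hh : h.PosDef) : ∃ E, IsFrame h E :=
  have ⟨E, hE⟩ := CStarAlgebra.nonneg_iff_eq_star_mul_self.1 hh.posSemidef.nonneg
  ⟨E, isFrame_of_posDef hh hE.symm⟩

lemma IsFrame.pullback_pullback_inv (hE : IsFrame h E) (T : Tensor ι ℂ n) :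
    pullback E (pullback E⁻¹ T) = T := by
  rw [← pullback_mul, Matrix.nonsing_inv_mul _ hE.isUnit_det, pullback_one]

lemma IsFrame.isSTFPart_iff (hE : IsFrame h E) {T S : Tensor ι ℂ n} :
    IsSTFPart h T S ↔ S = pullback E (euclideanSTFPart ι n (pullback E⁻¹ T)) := by
  have hone : E⁻¹.transpose * h * E⁻¹ = 1 := by
    rw [← hE.transpose_mul_self, Matrix.transpose_nonsing_inv, mul_assoc,
      Matrix.mul_nonsing_inv_cancel_right _ _ hE.isUnit_det,
      Matrix.nonsing_inv_mul _ (by simpa using hE.isUnit_det)]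
  constructor
  · intro hS
    have hinv := hS.pullback (Matrix.isUnit_nonsing_inv_det _ hE.isUnit_det)
    rw [hone] at hinv
    rw [← hinv.unique_one (isSTFPart_euclideanSTFPart _), hE.pullback_pullback_inv]
  · rintro rfl
    have := (isSTFPart_euclideanSTFPart (pullback E⁻¹ T)).pullback hE.isUnit_det
    rwa [mul_one, hE.transpose_mul_self, hE.pullback_pullback_inv] at this

lemma isSTFPart_stfPart (hh : h.PosDef) (T : Tensor ι ℂ n) : IsSTFPart h T (stfPart h T) :=
  have ⟨_, hE⟩ := exists_isFrame hh
  Classical.epsilon_spec ⟨_, hE.isSTFPart_iff.2 rfl⟩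

lemma IsFrame.stfPart_eq (hE : IsFrame h E) (T : Tensor ι ℂ n) :
    stfPart h T = pullback E (euclideanSTFPart ι n (pullback E⁻¹ T)) :=
  hE.isSTFPart_iff.1 (Classical.epsilon_spec ⟨_, hE.isSTFPart_iff.2 rfl⟩)

end Frame

/-! ### Contractions -/

section Contract

variable {n : ℕ} (v : Fin 3 → ℂ)

lemma contract_eq_dotProduct (T : Tensor (Fin 3) ℂ n) :
    contract v T = (fun I => ∏ k, v (I k)) ⬝ᵥ T :=
  rfl

lemma contract_add (S T : Tensor (Fin 3) ℂ n) :
    contract v (S + T) = contract v S + contract v T :=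
  dotProduct_add _ S T

lemma contract_sub (S T : Tensor (Fin 3) ℂ n) :
    contract v (S - T) = contract v S - contract v T :=
  dotProduct_sub _ S T

lemma contract_smul (c : ℂ) (T : Tensor (Fin 3) ℂ n) : contract v (c • T) = c * contract v T :=
  dotProduct_smul c _ T

lemma contract_sum {κ : Type*} (s : Finset κ) (T : κ → Tensor (Fin 3) ℂ n) :
    contract v (∑ i ∈ s, T i) = ∑ i ∈ s, contract v (T i) :=
  dotProduct_sum _ s T

lemma contract_zero (T : Tensor (Fin 3) ℂ 0) (I : Fin 0 → Fin 3) : contract v T = T I := by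
  simp [contract, Subsingleton.elim _ I]

lemma contract_symmetrize (T : Tensor (Fin 3) ℂ n) : contract v (symmetrize T) = contract v T := by
  have hsymm : IsSymmetric fun I : Fin n → Fin 3 => ∏ k, v (I k) := fun σ I =>
    Equiv.prod_comp σ fun k => v (I k)
  rw [contract_eq_dotProduct, dotProduct_symmetrize, hsymm.symmetrize_eq, contract_eq_dotProduct]

variable {v} {h : Matrix (Fin 3) (Fin 3) ℝ}

lemma contract_eq_zero_of_mem_traceTerms (hv : ∑ i, ∑ j, (h i j : ℂ) * (v i * v j) = 0)
    {T : Tensor (Fin 3) ℂ n} (hT : T ∈ traceTerms h n) : contract v T = 0 := by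
  induction hT using Submodule.span_induction with
  | zero => exact dotProduct_zero _
  | add S T _ _ hS hT => rw [contract_add, hS, hT, add_zero]
  | smul c T _ hT => rw [contract_smul, hT, mul_zero]
  | mem T hT =>
    obtain ⟨a, b, hab, q, hq, rfl⟩ := hT
    let s : Finset (Fin n) := (Finset.univ.erase a).erase b
    have hr (I J : Fin n → Fin 3) (hIJ : ∀ k, k ≠ a → k ≠ b → I k = J k) :
        q I * ∏ k ∈ s, v (I k) = q J * ∏ k ∈ s, v (J k) :=
      congrArg₂ (· * ·) (hq I J hIJ) (Finset.prod_congr rfl fun k hk => by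
        rw [hIJ k (Finset.ne_of_mem_erase (Finset.mem_of_mem_erase hk))
          (Finset.ne_of_mem_erase hk)])
    have hsplit (J : Fin n → Fin 3) : (∏ k, v (J k)) * ((h (J a) (J b) : ℂ) * q J) =
        (h (J a) (J b) * (v (J a) * v (J b))) * (q J * ∏ k ∈ s, v (J k)) := by
      rw [← Finset.mul_prod_erase _ _ (Finset.mem_univ a),
        ← Finset.mul_prod_erase _ _ (Finset.mem_erase.2 ⟨hab.symm, Finset.mem_univ b⟩)]
      ring
    rw [contract, Finset.sum_congr rfl fun J _ => hsplit J,
      sum_mul_eq_of_forall_eq hab (fun i j => (h i j : ℂ) * (v i * v j)) hr, hv, zero_mul]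

lemma IsSTFPart.contract_eq (hv : ∑ i, ∑ j, (h i j : ℂ) * (v i * v j) = 0)
    {T S : Tensor (Fin 3) ℂ n} (hS : IsSTFPart h T S) : contract v S = contract v T := by
  have hzero := contract_eq_zero_of_mem_traceTerms hv hS.2.2
  rw [contract_sub, contract_symmetrize, sub_eq_zero] at hzero
  exact hzero.symm

end Contract

/-- Insertion of a vector into the first slot, `v^a T_{a a₁ … aₙ}`. -/
noncomputable def contractFirst {n : ℕ} :
    (Fin 3 → ℂ) →ₗ[ℂ] Tensor (Fin 3) ℂ (n + 1) →ₗ[ℂ] Tensor (Fin 3) ℂ n :=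
  LinearMap.mk₂ ℂ (fun v T I => ∑ i, v i * T (Fin.cons i I))
    (fun v w T => by funext I; simp [add_mul, Finset.sum_add_distrib])
    (fun c v T => by funext I; simp [Finset.mul_sum, mul_assoc])
    (fun v S T => by funext I; simp [mul_add, Finset.sum_add_distrib])
    (fun c v T => by funext I; simp [Finset.mul_sum, mul_left_comm])

section ContractFirst

variable {n : ℕ}

lemma contractFirst_apply (v : Fin 3 → ℂ) (T : Tensor (Fin 3) ℂ (n + 1)) (I : Fin n → Fin 3) :
    contractFirst v T I = ∑ i, v i * T (Fin.cons i I) :=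
  rfl

lemma contractFirst_single (i : Fin 3) (T : Tensor (Fin 3) ℂ (n + 1)) :
    contractFirst (Pi.single i 1) T = fun I => T (Fin.cons i I) := by
  funext I
  simp [contractFirst_apply, Pi.single_apply]

lemma contractFirst_eq_sum (v : Fin 3 → ℂ) (T : Tensor (Fin 3) ℂ (n + 1)) :
    contractFirst v T = ∑ i, v i • contractFirst (Pi.single i 1) T := by
  funext I
  simp [contractFirst_apply, Pi.single_apply]

lemma contract_succ (v : Fin 3 → ℂ) (T : Tensor (Fin 3) ℂ (n + 1)) :
    contract v T = contract v (contractFirst v T) := by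
  simp only [contract, contractFirst_apply, Finset.mul_sum]
  rw [Finset.sum_comm, ← Fintype.sum_prod_type' fun (i : Fin 3) (I : Fin n → Fin 3) =>
    (∏ k, v (I k)) * (v i * T (Fin.cons i I))]
  refine (Fintype.sum_equiv (Fin.consEquiv fun _ => Fin 3) _ _ fun p => ?_).symm
  change _ = (∏ k, v ((Fin.cons p.1 p.2 : Fin (n + 1) → Fin 3) k)) * T (Fin.cons p.1 p.2)
  simp only [Fin.prod_univ_succ, Fin.cons_zero, Fin.cons_succ]
  ring

lemma IsSymmetric.contractFirst_single {T : Tensor (Fin 3) ℂ (n + 1)} (hT : IsSymmetric T)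
    (i : Fin 3) : IsSymmetric (contractFirst (Pi.single i 1) T) := by
  intro σ I
  simp only [GerochHansen.contractFirst_single]
  rw [← hT (Equiv.Perm.decomposeFin.symm (0, σ)) (Fin.cons i I)]
  congr 1
  funext k
  cases k using Fin.cases <;> simp

lemma IsSymmetric.apply_cons_cons {T : Tensor (Fin 3) ℂ (n + 2)} (hT : IsSymmetric T)
    (i j : Fin 3) (I : Fin n → Fin 3) :
    T (Fin.cons i (Fin.cons j I)) = T (Fin.cons j (Fin.cons i I)) := by
  rw [← hT (Equiv.swap 0 1) (Fin.cons j (Fin.cons i I))]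
  congr 1
  funext k
  cases k using Fin.cases with
  | zero => simp
  | succ k =>
    cases k using Fin.cases with
    | zero => simp
    | succ k =>
      have hk : k.succ.succ ≠ 1 := by
        rw [← Fin.succ_zero_eq_one]
        exact (Fin.succ_injective _).ne (Fin.succ_ne_zero k)
      simp [Equiv.swap_apply_of_ne_of_ne (Fin.succ_ne_zero _) hk]

lemma IsSymmetric.contractFirst_comm {T : Tensor (Fin 3) ℂ (n + 2)} (hT : IsSymmetric T)
    (v w : Fin 3 → ℂ) :
    contractFirst v (contractFirst w T) = contractFirst w (contractFirst v T) := by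
  funext I
  simp only [contractFirst_apply, Finset.mul_sum]
  rw [Finset.sum_comm]
  exact Finset.sum_congr rfl fun i _ => Finset.sum_congr rfl fun j _ => by
    rw [hT.apply_cons_cons, mul_left_comm]

lemma IsTraceFree.contractFirst_single {h : Matrix (Fin 3) (Fin 3) ℝ}
    {T : Tensor (Fin 3) ℂ (n + 1)} (hT : IsTraceFree h T) (i : Fin 3) :
    IsTraceFree h (contractFirst (Pi.single i 1) T) := by
  intro a b hab I
  simpa only [GerochHansen.contractFirst_single, Fin.cons_update] using
    hT a.succ b.succ (by simpa using hab) (Fin.cons i I)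

lemma IsTraceFree.sum_contractFirst_single_eq_zero {T : Tensor (Fin 3) ℂ (n + 2)}
    (hT : IsTraceFree 1 T) :
    ∑ i, contractFirst (Pi.single i 1) (contractFirst (Pi.single i 1) T) = 0 := by
  funext I
  have htrace := hT 1 0 one_ne_zero (Fin.cons 0 (Fin.cons 0 I))
  have hupdate (i j : Fin 3) : Function.update (Function.update
      (Fin.cons 0 (Fin.cons 0 I) : Fin (n + 2) → Fin 3) 1 i) 0 j = Fin.cons j (Fin.cons i I) := by
    rw [← Fin.succ_zero_eq_one, ← Fin.cons_update, Fin.update_cons_zero, Fin.update_cons_zero]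
  simpa [hupdate, Matrix.one_apply, apply_ite Complex.ofReal, contractFirst_apply,
    Pi.single_apply] using htrace

lemma contract_contractFirst (v w : Fin 3 → ℂ) (T : Tensor (Fin 3) ℂ (n + 1)) :
    contract v (contractFirst w T) =
      ∑ i, w i * contract v (contractFirst (Pi.single i 1) T) := by
  rw [contractFirst_eq_sum, contract_sum]
  simp only [contract_smul]

lemma contractFirst_contractFirst (v w : Fin 3 → ℂ) (T : Tensor (Fin 3) ℂ (n + 2)) :
    contractFirst v (contractFirst w T) =
      ∑ i, ∑ j, (v i * w j) • contractFirst (Pi.single i 1) (contractFirst (Pi.single j 1) T) := by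
  rw [contractFirst_eq_sum v, contractFirst_eq_sum w]
  simp only [map_sum, map_smul, Finset.smul_sum, smul_smul]

lemma hasDerivAt_contract {T : Tensor (Fin 3) ℂ (n + 1)} (hT : IsSymmetric T)
    {v : ℝ → Fin 3 → ℂ} {v' : Fin 3 → ℂ} {α : ℝ} (hv : HasDerivAt v v' α) :
    HasDerivAt (fun β => contract (v β) T) ((n + 1) * contract (v α) (contractFirst v' T)) α := by
  have hvi := hasDerivAt_pi.1 hv
  induction n with
  | zero =>
    simp only [contract_succ, contract_zero _ _ Fin.elim0, contractFirst_apply, Nat.cast_zero,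
      zero_add, one_mul]
    exact HasDerivAt.fun_sum fun i _ => (hvi i).mul_const _
  | succ n ih =>
    have hsum : HasDerivAt (fun β => contract (v β) T)
        (∑ i, (v' i * contract (v α) (contractFirst (Pi.single i 1) T) + v α i * ((n + 1) *
          contract (v α) (contractFirst v' (contractFirst (Pi.single i 1) T))))) α := by
      rw [funext fun β => (contract_succ (v β) T).trans (contract_contractFirst _ _ T)]
      exact HasDerivAt.fun_sum fun i _ => (hvi i).mul (ih (hT.contractFirst_single i))
    convert hsum using 1
    simp only [hT.contractFirst_comm v', mul_left_comm _ ((n : ℂ) + 1)]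
    rw [Finset.sum_add_distrib, ← contract_contractFirst, ← Finset.mul_sum,
      ← contract_contractFirst, ← contract_succ]
    push_cast
    ring

lemma hasDerivAt_contract_contractFirst {T : Tensor (Fin 3) ℂ (n + 2)} (hT : IsSymmetric T)
    {v w : ℝ → Fin 3 → ℂ} {v' w' : Fin 3 → ℂ} {α : ℝ} (hv : HasDerivAt v v' α)
    (hw : HasDerivAt w w' α) :
    HasDerivAt (fun β => contract (v β) (contractFirst (w β) T))
      (contract (v α) (contractFirst w' T) +
        (n + 1) * contract (v α) (contractFirst v' (contractFirst (w α) T))) α := by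
  have hsum : HasDerivAt (fun β => contract (v β) (contractFirst (w β) T))
      (∑ i, (w' i * contract (v α) (contractFirst (Pi.single i 1) T) + w α i * ((n + 1) *
        contract (v α) (contractFirst v' (contractFirst (Pi.single i 1) T))))) α := by
    rw [funext fun β => contract_contractFirst (v β) (w β) T]
    exact HasDerivAt.fun_sum fun i _ => (hasDerivAt_pi.1 hw i).mul
      (hasDerivAt_contract (hT.contractFirst_single i) hv)
  convert hsum using 1
  simp only [hT.contractFirst_comm v', mul_left_comm _ ((n : ℂ) + 1)]
  rw [Finset.sum_add_distrib, ← contract_contractFirst, ← Finset.mul_sum,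
    ← contract_contractFirst]

end ContractFirst

/-! ### Tensors vanishing on the null vectors `η` -/

/-- The derivative `∂η/∂φ` of the null vector `η` with respect to the angle of the meridian
plane. -/
noncomputable def etaDeriv (α : ℝ) : Fin 3 → ℂ :=
  ![Complex.I * Real.sin α, -Complex.I * Real.cos α, 0]

lemma hasDerivAt_eta (α : ℝ) : HasDerivAt eta (etaDeriv α) α := by
  have hcos := (Real.hasDerivAt_cos α).ofReal_comp.const_mul (-Complex.I)
  have hsin := (Real.hasDerivAt_sin α).ofReal_comp.const_mul (-Complex.I)
  refine hasDerivAt_pi.2 fun i => ?_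
  fin_cases i
  · simpa [eta, etaDeriv] using hcos
  · simpa [eta, etaDeriv] using hsin
  · exact hasDerivAt_const α 1

lemma hasDerivAt_etaDeriv (α : ℝ) : HasDerivAt etaDeriv (Pi.single 2 1 - eta α) α := by
  have hcos := (Real.hasDerivAt_cos α).ofReal_comp.const_mul (-Complex.I)
  have hsin := (Real.hasDerivAt_sin α).ofReal_comp.const_mul Complex.I
  refine hasDerivAt_pi.2 fun i => ?_
  fin_cases i
  · simpa [eta, etaDeriv] using hsin
  · simpa [eta, etaDeriv] using hcos
  · simpa [eta, etaDeriv] using hasDerivAt_const α (0 : ℂ)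

lemma etaDeriv_mul_etaDeriv (α : ℝ) (i j : Fin 3) :
    etaDeriv α i * etaDeriv α j = eta α i * (Pi.single 2 1 : Fin 3 → ℂ) j +
      (Pi.single 2 1 : Fin 3 → ℂ) i * eta α j - eta α i * eta α j - if i = j then 1 else 0 := by
  have hcs : Complex.sin α ^ 2 + Complex.cos α ^ 2 = 1 := Complex.sin_sq_add_cos_sq _
  have hI := Complex.I_sq
  fin_cases i <;> fin_cases j <;> simp [eta, etaDeriv]
  · linear_combination (Complex.sin α ^ 2 + Complex.cos α ^ 2) * hI - hcs
  · ring
  · ring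
  · linear_combination (Complex.sin α ^ 2 + Complex.cos α ^ 2) * hI - hcs

lemma eq_eta_add_etaDeriv_add_single (α : ℝ) (w : Fin 3 → ℂ) :
    w = (Complex.I * (w 0 * Complex.cos α + w 1 * Complex.sin α)) • (eta α - Pi.single 2 1) +
      (Complex.I * (w 1 * Complex.cos α - w 0 * Complex.sin α)) • etaDeriv α +
      w 2 • Pi.single 2 1 := by
  have hcs : Complex.sin α ^ 2 + Complex.cos α ^ 2 = 1 := Complex.sin_sq_add_cos_sq _
  have hI := Complex.I_sq
  funext i
  fin_cases i <;> simp [eta, etaDeriv, Matrix.vecHead, Matrix.vecTail]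
  · linear_combination w 0 * (Complex.sin α ^ 2 + Complex.cos α ^ 2) * hI - w 0 * hcs
  · linear_combination w 1 * (Complex.sin α ^ 2 + Complex.cos α ^ 2) * hI - w 1 * hcs

section EtaVanishing

variable {n : ℕ} {D : Tensor (Fin 3) ℂ (n + 1)}

lemma contract_contractFirst_etaDeriv_eq_zero (hD : IsSymmetric D)
    (h : ∀ α, contract (eta α) D = 0) (α : ℝ) :
    contract (eta α) (contractFirst (etaDeriv α) D) = 0 := by
  have hderiv := hasDerivAt_contract hD (hasDerivAt_eta α)
  simp only [h] at hderiv
  exact (mul_eq_zero.1 (hderiv.unique (hasDerivAt_const α 0))).resolve_left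
    (by exact_mod_cast n.succ_ne_zero)

lemma contractFirst_etaDeriv_etaDeriv {D : Tensor (Fin 3) ℂ (n + 2)} (hD : IsSymmetric D)
    (hD' : IsTraceFree 1 D) (α : ℝ) :
    contractFirst (etaDeriv α) (contractFirst (etaDeriv α) D) =
      (2 : ℂ) • contractFirst (eta α) (contractFirst (Pi.single 2 1) D) -
        contractFirst (eta α) (contractFirst (eta α) D) := by
  rw [contractFirst_contractFirst]
  simp only [etaDeriv_mul_etaDeriv, add_smul, sub_smul, ite_smul, one_smul, zero_smul,
    Finset.sum_add_distrib, Finset.sum_sub_distrib, ← contractFirst_contractFirst,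
    Finset.sum_ite_eq, Finset.mem_univ, if_true, hD'.sum_contractFirst_single_eq_zero]
  rw [hD.contractFirst_comm (Pi.single 2 1), two_smul, sub_zero]

lemma contract_contractFirst_single_two_eq_zero (hD : IsSymmetric D) (hD' : IsTraceFree 1 D)
    (h : ∀ α, contract (eta α) D = 0) (α : ℝ) :
    contract (eta α) (contractFirst (Pi.single 2 1) D) = 0 := by
  have hzero := contract_contractFirst_etaDeriv_eq_zero hD h
  cases n with
  | zero =>
    have hderiv := hasDerivAt_contract hD (hasDerivAt_etaDeriv α)
    have hconst (β : ℝ) : contract (etaDeriv β) D = 0 := by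
      rw [← hzero β, contract_succ, contract_zero _ _ Fin.elim0, contract_zero _ _ Fin.elim0]
    simp only [hconst] at hderiv
    have heq := hderiv.unique (hasDerivAt_const α 0)
    rw [contract_zero _ _ Fin.elim0, ← contract_zero (eta α) (contractFirst _ D), map_sub,
      LinearMap.sub_apply, contract_sub, ← contract_succ, h] at heq
    simpa using heq
  | succ n =>
    have hderiv := hasDerivAt_contract_contractFirst hD (hasDerivAt_eta α) (hasDerivAt_etaDeriv α)
    simp only [hzero] at hderiv
    have heq := hderiv.unique (hasDerivAt_const α 0)
    rw [contractFirst_etaDeriv_etaDeriv hD hD', map_sub, LinearMap.sub_apply, contract_sub,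
      contract_sub, contract_smul, ← contract_succ (eta α) D, ← contract_succ,
      ← contract_succ, ← contract_succ, h] at heq
    have hne : (2 * n + 3 : ℂ) ≠ 0 := by exact_mod_cast (2 * n + 2).succ_ne_zero
    refine (mul_eq_zero.1 ?_).resolve_left hne
    linear_combination heq

lemma contract_contractFirst_eq_zero (hD : IsSymmetric D) (hD' : IsTraceFree 1 D)
    (h : ∀ α, contract (eta α) D = 0) (w : Fin 3 → ℂ) (α : ℝ) :
    contract (eta α) (contractFirst w D) = 0 := by
  rw [eq_eta_add_etaDeriv_add_single α w]
  simp only [map_add, map_sub, map_smul, LinearMap.add_apply, LinearMap.sub_apply,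
    LinearMap.smul_apply, contract_add, contract_sub, contract_smul, ← contract_succ, h,
    contract_contractFirst_etaDeriv_eq_zero hD h,
    contract_contractFirst_single_two_eq_zero hD hD' h, sub_zero, mul_zero, add_zero]

end EtaVanishing

lemma eq_zero_of_contract_eta {n : ℕ} {D : Tensor (Fin 3) ℂ n} (hD : IsSymmetric D)
    (hD' : IsTraceFree 1 D) (h : ∀ α, contract (eta α) D = 0) : D = 0 := by
  induction n with
  | zero => exact funext fun I => contract_zero (eta 0) D I ▸ h 0
  | succ n ih =>
    funext I
    have hzero := ih (hD.contractFirst_single (I 0)) (hD'.contractFirst_single (I 0))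
      (contract_contractFirst_eq_zero hD hD' h _)
    rw [contractFirst_single] at hzero
    simpa using congrFun hzero (Fin.tail I)

/-! ### Smoothness of the tensor calculus -/

section SmoothFrame

open scoped Topology

lemma exists_contDiffAt_sqrt_one (R : Type*) [NormedRing R] [NormedAlgebra ℝ R] [CompleteSpace R] :
    ∃ S : R → R, ContDiffAt ℝ ∞ S 1 ∧ S 1 = 1 ∧ (∀ᶠ a in 𝓝 1, S a * S a = a) ∧
      ∀ᶠ b in 𝓝 1, S (b * b) = b := by
  let double : R ≃L[ℝ] R := ContinuousLinearEquiv.smulLeft (Units.mk0 (2 : ℝ) two_ne_zero)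
  have hsmooth : ContDiffAt ℝ ∞ (fun b : R => b * b) 1 := contDiffAt_id.mul contDiffAt_id
  have hderiv : HasFDerivAt (fun b : R => b * b) (double : R →L[ℝ] R) 1 := by
    have hmul := (hasFDerivAt_id (𝕜 := ℝ) (1 : R)).mul' (hasFDerivAt_id 1)
    refine hmul.congr_fderiv (ContinuousLinearMap.ext fun b => ?_)
    change 1 * b + b * 1 = (2 : ℝ) • b
    rw [one_mul, mul_one, two_smul]
  have hstrict := hsmooth.hasStrictFDerivAt' hderiv (by simp)
  have hinv := hsmooth.to_localInverse hderiv (by simp)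
  have himage := hsmooth.localInverse_apply_image hderiv (by simp)
  have hright := hstrict.eventually_right_inverse
  rw [mul_one] at hinv himage hright
  exact ⟨_, hinv, himage, hright, hstrict.eventually_left_inverse⟩

open scoped Matrix.Norms.Operator

variable {ι : Type} [Fintype ι]

lemma contDiffAt_matrix {X : Type*} [NormedAddCommGroup X] [NormedSpace ℝ X] {x : X}
    {A : X → Matrix ι ι ℝ} :
    ContDiffAt ℝ ∞ A x ↔ ∀ i j, ContDiffAt ℝ ∞ (fun y => A y i j) x := by
  classical
  refine ⟨fun hA i j => ?_, fun hA => ?_⟩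
  · let entry := LinearMap.toContinuousLinearMap (Matrix.entryLinearMap ℝ ℝ i j)
    exact entry.contDiff.comp_contDiffAt x hA
  · rw [funext fun y => Matrix.matrix_eq_sum_single (A y)]
    refine ContDiffAt.sum fun i _ => ContDiffAt.sum fun j _ => ?_
    let single := LinearMap.toContinuousLinearMap (Matrix.singleLinearMap (α := ℝ) ℝ i j)
    exact single.contDiff.comp_contDiffAt x (hA i j)

variable [DecidableEq ι]

lemma exists_contDiffAt_symmetric_sqrt :
    ∃ S : Matrix ι ι ℝ → Matrix ι ι ℝ, ContDiffAt ℝ ∞ S 1 ∧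
      ∀ᶠ A in 𝓝 1, A.IsSymm → (S A).transpose * S A = A := by
  obtain ⟨S, hsmooth, hone, hsquare, hunique⟩ := exists_contDiffAt_sqrt_one (Matrix ι ι ℝ)
  have htranspose : ContDiffAt ℝ ∞ (fun A => (S A).transpose) 1 :=
    contDiffAt_matrix.2 fun i j => contDiffAt_matrix.1 hsmooth j i
  have htranspose_one : (S 1).transpose = 1 := by rw [hone, Matrix.transpose_one]
  refine ⟨S, hsmooth, ?_⟩
  have hunique' := htranspose.continuousAt.eventually (htranspose_one ▸ hunique)
  filter_upwards [hsquare, hunique'] with A hA hAT hsymm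
  rw [← Matrix.transpose_mul, hA, hsymm.eq] at hAT
  rw [← hAT, hA]

lemma exists_contDiffAt_isFrame {X : Type*} [NormedAddCommGroup X] [NormedSpace ℝ X]
    {G : X → Matrix ι ι ℝ} {x : X} (hG : ∀ i j, ContDiffAt ℝ ∞ (fun y => G y i j) x)
    (hpos : ∀ᶠ y in 𝓝 x, (G y).PosDef) :
    ∃ E : X → Matrix ι ι ℝ, (∀ i j, ContDiffAt ℝ ∞ (fun y => E y i j) x) ∧
      ∀ᶠ y in 𝓝 x, IsFrame (G y) (E y) := by
  obtain ⟨F, hF⟩ := exists_isFrame hpos.self_of_nhds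
  obtain ⟨S, hS, hSA⟩ := exists_contDiffAt_symmetric_sqrt (ι := ι)
  let A (y : X) : Matrix ι ι ℝ := F⁻¹.transpose * G y * F⁻¹
  have hA : ContDiffAt ℝ ∞ A x :=
    (contDiffAt_const.mul (contDiffAt_matrix.2 hG)).mul contDiffAt_const
  have hFT : IsUnit F.transpose.det := by simpa using hF.isUnit_det
  have hAx : A x = 1 := by
    simp only [A, ← hF.transpose_mul_self, Matrix.transpose_nonsing_inv, ← mul_assoc,
      Matrix.nonsing_inv_mul _ hFT, one_mul, Matrix.mul_nonsing_inv _ hF.isUnit_det]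
  have hGA (y : X) : F.transpose * A y * F = G y := by
    simp only [A, Matrix.transpose_nonsing_inv, ← mul_assoc, Matrix.mul_nonsing_inv _ hFT, one_mul,
      Matrix.nonsing_inv_mul_cancel_right _ _ hF.isUnit_det]
  refine ⟨fun y => S (A y) * F, contDiffAt_matrix.1 ?_, ?_⟩
  · exact ((hAx ▸ hS : ContDiffAt ℝ ∞ S (A x)).comp x hA).mul contDiffAt_const
  · have hnear : ∀ᶠ y in 𝓝 x, (A y).IsSymm → (S (A y)).transpose * S (A y) = A y :=
      hA.continuousAt.eventually (hAx ▸ hSA)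
    filter_upwards [hnear, hpos] with y hy hGy
    refine isFrame_of_posDef hGy ?_
    have hsymm : (A y).IsSymm := by
      have hGsymm : (G y).transpose = G y := hGy.isHermitian
      simp only [A, Matrix.IsSymm, Matrix.transpose_mul, Matrix.transpose_transpose, hGsymm,
        mul_assoc]
    rw [Matrix.transpose_mul, ← mul_assoc, mul_assoc F.transpose, hy hsymm, hGA]

end SmoothFrame

section Smooth

variable {ι F : Type} [Fintype ι] [NormedAddCommGroup F] [NormedSpace ℝ F]
  {G : (ι → ℝ) → Matrix ι ι ℝ} {x : ι → ℝ} {n : ℕ}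

lemma contDiffAt_pullback {E : (ι → ℝ) → Matrix ι ι ℝ}
    (hE : ∀ i j, ContDiffAt ℝ ∞ (fun y => E y i j) x) {T : (ι → ℝ) → Tensor ι ℂ n}
    (hT : ∀ I, ContDiffAt ℝ ∞ (fun y => T y I) x) (I : Fin n → ι) :
    ContDiffAt ℝ ∞ (fun y => pullback (E y) (T y) I) x := by
  simp only [pullback_apply]
  exact ContDiffAt.sum fun J _ => (hT J).mul <| contDiffAt_prod fun k _ =>
      Complex.ofRealCLM.contDiff.comp_contDiffAt x (hE (J k) (I k))

variable [DecidableEq ι]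

lemma contDiffAt_pderiv {f : (ι → ℝ) → F} (hf : ContDiffAt ℝ ∞ f x) (i : ι) :
    ContDiffAt ℝ ∞ (pderiv i f) x :=
  (hf.fderiv_right (m := ∞) (by simp)).clm_apply contDiffAt_const

open scoped Matrix.Norms.Operator in
lemma contDiffAt_inv_apply {A : (ι → ℝ) → Matrix ι ι ℝ}
    (hA : ∀ i j, ContDiffAt ℝ ∞ (fun y => A y i j) x) (hdet : IsUnit (A x).det) (i j : ι) :
    ContDiffAt ℝ ∞ (fun y => (A y)⁻¹ i j) x := by
  have hinv := contDiffAt_ringInverse ℝ (n := ∞) ((Matrix.isUnit_iff_isUnit_det _).2 hdet).unit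
  simp only [Matrix.nonsing_inv_eq_ringInverse]
  exact contDiffAt_matrix.1 (hinv.comp x (contDiffAt_matrix.2 hA)) i j

lemma contDiffAt_christoffel (hG : ∀ i j, ContDiffAt ℝ ∞ (fun y => G y i j) x)
    (hdet : IsUnit (G x).det) (k i j : ι) : ContDiffAt ℝ ∞ (christoffel G k i j) x :=
  contDiffAt_const.mul <| ContDiffAt.sum fun l _ => (contDiffAt_inv_apply hG hdet k l).mul
    (((contDiffAt_pderiv (hG l j) i).add (contDiffAt_pderiv (hG l i) j)).sub
      (contDiffAt_pderiv (hG i j) l))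

lemma contDiffAt_ricci (hG : ∀ i j, ContDiffAt ℝ ∞ (fun y => G y i j) x)
    (hdet : IsUnit (G x).det) (i j : ι) : ContDiffAt ℝ ∞ (fun y => ricci G y i j) x := by
  have hΓ := contDiffAt_christoffel hG hdet
  refine ContDiffAt.add (ContDiffAt.sum fun k _ => ?_)
    (ContDiffAt.sum fun k _ => ContDiffAt.sum fun l _ => ?_)
  · exact (contDiffAt_pderiv (hΓ k i j) k).sub (contDiffAt_pderiv (hΓ k i k) j)
  · exact ((hΓ k k l).mul (hΓ l i j)).sub ((hΓ k j l).mul (hΓ l i k))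

lemma contDiffAt_covDeriv (hG : ∀ i j, ContDiffAt ℝ ∞ (fun y => G y i j) x)
    (hdet : IsUnit (G x).det) {T : (ι → ℝ) → Tensor ι F n}
    (hT : ∀ I, ContDiffAt ℝ ∞ (fun y => T y I) x) (I : Fin (n + 1) → ι) :
    ContDiffAt ℝ ∞ (fun y => covDeriv G T y I) x :=
  (contDiffAt_pderiv (hT _) _).sub <| ContDiffAt.sum fun _ _ => ContDiffAt.sum fun _ _ =>
    (contDiffAt_christoffel hG hdet _ _ _).smul (hT _)

open scoped Topology

lemma contDiffAt_stfPart (hG : ∀ i j, ContDiffAt ℝ ∞ (fun y => G y i j) x)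
    (hpos : ∀ᶠ y in 𝓝 x, (G y).PosDef) {T : (ι → ℝ) → Tensor ι ℂ n}
    (hT : ∀ I, ContDiffAt ℝ ∞ (fun y => T y I) x) (I : Fin n → ι) :
    ContDiffAt ℝ ∞ (fun y => stfPart (G y) (T y) I) x := by
  obtain ⟨E, hE, hframe⟩ := exists_contDiffAt_isFrame hG hpos
  let C := LinearMap.toContinuousLinearMap ((euclideanSTFPart ι n).restrictScalars ℝ)
  have hinv := contDiffAt_inv_apply hE hframe.self_of_nhds.isUnit_det
  have hC : ContDiffAt ℝ ∞ (fun y => C (pullback (E y)⁻¹ (T y))) x :=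
    C.contDiff.comp_contDiffAt x (contDiffAt_pi.2 (contDiffAt_pullback hinv hT))
  refine (contDiffAt_pullback hE (contDiffAt_pi.1 hC) I).congr_of_eventuallyEq ?_
  filter_upwards [hframe] with y hy
  exact congrFun (hy.stfPart_eq (T y)) I

lemma contDiffAt_multipoleTensor (hG : ∀ i j, ContDiffAt ℝ ∞ (fun y => G y i j) x)
    (hpos : ∀ᶠ y in 𝓝 x, (G y).PosDef) {φ : (ι → ℝ) → ℂ} (hφ : ContDiffAt ℝ ∞ φ x) (n : ℕ)
    (I : Fin n → ι) : ContDiffAt ℝ ∞ (fun y => multipoleTensor G φ n y I) x := by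
  have hdet : IsUnit (G x).det :=
    (Matrix.isUnit_iff_isUnit_det _).1 hpos.self_of_nhds.isUnit
  induction n using Nat.twoStepInduction with
  | zero => exact hφ
  | one =>
    simp only [multipoleTensor]
    exact contDiffAt_stfPart hG hpos (contDiffAt_covDeriv hG hdet fun _ => hφ) I
  | more n hn hn' =>
    simp only [multipoleTensor]
    refine contDiffAt_stfPart hG hpos (fun J => (contDiffAt_covDeriv hG hdet hn' J).sub ?_) I
    refine (contDiffAt_const.mul ?_).mul (hn _)
    exact Complex.ofRealCLM.contDiff.comp_contDiffAt x (contDiffAt_ricci hG hdet _ _)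

end Smooth

/-! ### Linear isometries -/

section Isometry

open scoped Matrix Matrix.Norms.Operator Topology

lemma fderiv_matrix_apply {X ι : Type*} [NormedAddCommGroup X] [NormedSpace ℝ X] [Finite ι]
    {A : X → Matrix ι ι ℝ} {x : X} (hA : DifferentiableAt ℝ A x) (v : X) (i j : ι) :
    fderiv ℝ A x v i j = fderiv ℝ (fun y => A y i j) x v := by
  have := Fintype.ofFinite ι
  let entry := LinearMap.toContinuousLinearMap (Matrix.entryLinearMap ℝ ℝ i j)
  have h : HasFDerivAt (fun y => A y i j) (entry.comp (fderiv ℝ A x)) x :=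
    entry.hasFDerivAt.comp x hA.hasFDerivAt
  rw [h.fderiv]
  rfl

variable {ι : Type} [Fintype ι] {x : ι → ℝ}

lemma fderiv_mul_comp_mulVec_mul {A : (ι → ℝ) → Matrix ι ι ℝ} {R : Matrix ι ι ℝ}
    (hA : DifferentiableAt ℝ A (R *ᵥ x)) (B C : Matrix ι ι ℝ) (v : ι → ℝ) :
    fderiv ℝ (fun y => B * A (R *ᵥ y) * C) x v = B * fderiv ℝ A (R *ᵥ x) (R *ᵥ v) * C := by
  classical
  have hR := (Matrix.mulVecLin R).toContinuousLinearMap.hasFDerivAt (x := x)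
  have h := ((hA.hasFDerivAt.comp x hR).const_mul B).mul_const' C
  exact congrArg (fun D => D v) h.fderiv

variable [DecidableEq ι] {G : (ι → ℝ) → Matrix ι ι ℝ}

lemma sum_mul_christoffel (hdet : IsUnit (G x).det) (m i j : ι) :
    ∑ k, G x m k * christoffel G k i j x = (1 / 2) * (pderiv i (fun y => G y m j) x +
      pderiv j (fun y => G y m i) x - pderiv m (fun y => G y i j) x) := by
  let w (l : ι) : ℝ := (1 / 2) * (pderiv i (fun y => G y l j) x +
    pderiv j (fun y => G y l i) x - pderiv l (fun y => G y i j) x)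
  have hΓ : (fun k => christoffel G k i j x) = (G x)⁻¹ *ᵥ w := by
    funext k
    simp only [christoffel, Matrix.mulVec, dotProduct, w, Finset.mul_sum]
    exact Finset.sum_congr rfl fun l _ => by ring
  calc ∑ k, G x m k * christoffel G k i j x = (G x *ᵥ fun k => christoffel G k i j x) m := rfl
    _ = w m := by rw [hΓ, Matrix.mulVec_mulVec, Matrix.mul_nonsing_inv _ hdet, Matrix.one_mulVec]

lemma christoffel_comm (hG : ∀ᶠ y in 𝓝 x, (G y).IsSymm) (k i j : ι) :
    christoffel G k i j x = christoffel G k j i x := by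
  have hsymm (l : ι) : pderiv l (fun y => G y i j) x = pderiv l (fun y => G y j i) x := by
    have heq : (fun y => G y i j) =ᶠ[𝓝 x] fun y => G y j i := hG.mono fun y hy => hy.apply j i
    rw [pderiv, pderiv, heq.fderiv_eq]
  simp only [christoffel, hsymm, add_comm]

/-- The matrix `v^i Γ^k_{ij}` (row `k`, column `j`) of the endomorphism `u ↦ D_v u - ∂_v u`. -/
noncomputable def connectionMatrix (G : (ι → ℝ) → Matrix ι ι ℝ) (v x : ι → ℝ) : Matrix ι ι ℝ :=
  Matrix.of fun k j => ∑ i, v i * christoffel G k i j x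

/-- The matrix of the curvature endomorphism `D_u D_v - D_v D_u` for constant fields `u`, `v`. -/
noncomputable def curvatureMatrix (G : (ι → ℝ) → Matrix ι ι ℝ) (u v x : ι → ℝ) : Matrix ι ι ℝ :=
  fderiv ℝ (connectionMatrix G v) x u - fderiv ℝ (connectionMatrix G u) x v +
    (connectionMatrix G u x * connectionMatrix G v x -
      connectionMatrix G v x * connectionMatrix G u x)

lemma dotProduct_map_mulVec (D : (ι → ℝ) →L[ℝ] Matrix ι ι ℝ) (u v w : ι → ℝ) :
    w ⬝ᵥ D v *ᵥ u = ∑ m, ∑ i, ∑ j, w m * (v i * u j) * D (Pi.single i 1) m j := by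
  have hDv : D v = ∑ i, v i • D (Pi.single i 1) := by
    conv_lhs => rw [pi_eq_sum_univ' v]
    simp only [map_sum, map_smul]
  simp only [hDv, Matrix.mulVec, dotProduct, Matrix.sum_apply, Matrix.smul_apply, smul_eq_mul,
    Finset.mul_sum, Finset.sum_mul]
  refine Finset.sum_congr rfl fun m _ => ?_
  rw [Finset.sum_comm]
  exact Finset.sum_congr rfl fun i _ => Finset.sum_congr rfl fun j _ => by ring

lemma dotProduct_mul_connectionMatrix_mulVec (hG : DifferentiableAt ℝ G x)
    (hdet : IsUnit (G x).det) (u v w : ι → ℝ) :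
    w ⬝ᵥ (G x * connectionMatrix G v x) *ᵥ u = (1 / 2) * (w ⬝ᵥ fderiv ℝ G x v *ᵥ u +
      w ⬝ᵥ fderiv ℝ G x u *ᵥ v - v ⬝ᵥ fderiv ℝ G x w *ᵥ u) := by
  have hentry (m j : ι) : (G x * connectionMatrix G v x) m j =
      ∑ i, v i * ∑ k, G x m k * christoffel G k i j x := by
    simp only [Matrix.mul_apply, connectionMatrix, Matrix.of_apply, Finset.mul_sum]
    rw [Finset.sum_comm]
    exact Finset.sum_congr rfl fun i _ => Finset.sum_congr rfl fun k _ => by ring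
  have hkoszul : w ⬝ᵥ (G x * connectionMatrix G v x) *ᵥ u =
      (1 / 2) * ∑ m, ∑ i, ∑ j, w m * (v i * u j) * (fderiv ℝ G x (Pi.single i 1) m j +
        fderiv ℝ G x (Pi.single j 1) m i - fderiv ℝ G x (Pi.single m 1) i j) := by
    simp only [dotProduct, Matrix.mulVec, hentry, sum_mul_christoffel hdet, pderiv,
      ← fderiv_matrix_apply hG, Finset.mul_sum, Finset.sum_mul]
    refine Finset.sum_congr rfl fun m _ => ?_
    rw [Finset.sum_comm]
    exact Finset.sum_congr rfl fun i _ => Finset.sum_congr rfl fun j _ => by ring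
  rw [hkoszul, dotProduct_map_mulVec, dotProduct_map_mulVec, dotProduct_map_mulVec]
  simp only [mul_add, mul_sub, Finset.sum_add_distrib, Finset.sum_sub_distrib]
  congr 2
  · congr 1
    refine Finset.sum_congr rfl fun m _ => ?_
    rw [Finset.sum_comm]
    exact Finset.sum_congr rfl fun j _ => Finset.sum_congr rfl fun i _ => by ring
  · rw [Finset.sum_comm]
    refine Finset.sum_congr rfl fun i _ => Finset.sum_congr rfl fun m _ =>
      Finset.sum_congr rfl fun j _ => by ring

variable {R : Matrix ι ι ℝ}

lemma connectionMatrix_eq_of_isometry (hR : IsUnit R.det) (hG : DifferentiableAt ℝ G (R *ᵥ x))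
    (hdet : IsUnit (G (R *ᵥ x)).det) (hGR : ∀ᶠ y in 𝓝 x, G y = Rᵀ * G (R *ᵥ y) * R) (v : ι → ℝ) :
    connectionMatrix G v x = R⁻¹ * connectionMatrix G (R *ᵥ v) (R *ᵥ x) * R := by
  have hRT : IsUnit (Rᵀ).det := by rwa [Matrix.det_transpose]
  have hGx := hGR.self_of_nhds
  have hdetx : IsUnit (G x).det := by
    rw [hGx, Matrix.det_mul, Matrix.det_mul]
    exact (hRT.mul hdet).mul hR
  have hderiv (v : ι → ℝ) : fderiv ℝ G x v = Rᵀ * fderiv ℝ G (R *ᵥ x) (R *ᵥ v) * R := by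
    have heq : G =ᶠ[𝓝 x] fun y => Rᵀ * G (R *ᵥ y) * R := hGR
    rw [heq.fderiv_eq, fderiv_mul_comp_mulVec_mul hG]
  have hdiff : DifferentiableAt ℝ G x := by
    have hRx := (Matrix.mulVecLin R).toContinuousLinearMap.differentiableAt (x := x)
    exact (((hG.comp x hRx).const_mul Rᵀ).mul_const R).congr_of_eventuallyEq hGR
  have hpair (A : Matrix ι ι ℝ) (u w : ι → ℝ) :
      w ⬝ᵥ (Rᵀ * A * R) *ᵥ u = (R *ᵥ w) ⬝ᵥ A *ᵥ (R *ᵥ u) := by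
    rw [mul_assoc, ← Matrix.mulVec_mulVec, ← Matrix.mulVec_mulVec, Matrix.dotProduct_mulVec,
      Matrix.vecMul_transpose]
  have hlower : G x * connectionMatrix G v x =
      Rᵀ * (G (R *ᵥ x) * connectionMatrix G (R *ᵥ v) (R *ᵥ x)) * R := by
    refine Matrix.ext_of_mulVec_single fun j => ?_
    refine dotProduct_eq _ _ fun w => ?_
    rw [dotProduct_comm, dotProduct_comm _ w, hpair,
      dotProduct_mul_connectionMatrix_mulVec hdiff hdetx,
      dotProduct_mul_connectionMatrix_mulVec hG hdet]
    simp only [hderiv, hpair]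
  calc connectionMatrix G v x = (G x)⁻¹ * (G x * connectionMatrix G v x) := by
        rw [Matrix.nonsing_inv_mul_cancel_left _ _ hdetx]
    _ = R⁻¹ * ((G (R *ᵥ x))⁻¹ * ((Rᵀ)⁻¹ * (Rᵀ * (G (R *ᵥ x) *
          (connectionMatrix G (R *ᵥ v) (R *ᵥ x) * R))))) := by
        rw [hlower, hGx, Matrix.mul_inv_rev, Matrix.mul_inv_rev]
        simp only [mul_assoc]
    _ = R⁻¹ * connectionMatrix G (R *ᵥ v) (R *ᵥ x) * R := by
        rw [Matrix.nonsing_inv_mul_cancel_left _ _ hRT, Matrix.nonsing_inv_mul_cancel_left _ _ hdet,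
          mul_assoc]

lemma contDiffAt_connectionMatrix (hG : ∀ i j, ContDiffAt ℝ ∞ (fun y => G y i j) x)
    (hdet : IsUnit (G x).det) (v : ι → ℝ) : ContDiffAt ℝ ∞ (connectionMatrix G v) x :=
  contDiffAt_matrix.2 fun k j => ContDiffAt.sum fun i _ =>
    contDiffAt_const.mul (contDiffAt_christoffel hG hdet k i j)

lemma curvatureMatrix_eq_of_isometry (hR : IsUnit R.det)
    (hG : ∀ᶠ y in 𝓝 (R *ᵥ x), (∀ i j, ContDiffAt ℝ ∞ (fun z => G z i j) y) ∧ IsUnit (G y).det)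
    (hGR : ∀ᶠ y in 𝓝 x, G y = Rᵀ * G (R *ᵥ y) * R) (u v : ι → ℝ) :
    curvatureMatrix G u v x = R⁻¹ * curvatureMatrix G (R *ᵥ u) (R *ᵥ v) (R *ᵥ x) * R := by
  have hnear : ∀ᶠ y in 𝓝 x, ∀ v, connectionMatrix G v y =
      R⁻¹ * connectionMatrix G (R *ᵥ v) (R *ᵥ y) * R := by
    have hcont : Filter.Tendsto (R *ᵥ ·) (𝓝 x) (𝓝 (R *ᵥ x)) :=
      (Matrix.mulVecLin R).continuous_of_finiteDimensional.tendsto x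
    filter_upwards [hcont.eventually hG, hGR.eventually_nhds] with y hy hyR v
    exact connectionMatrix_eq_of_isometry hR
      ((contDiffAt_matrix.2 hy.1).differentiableAt (by simp)) hy.2 hyR v
  have hderiv (u v : ι → ℝ) : fderiv ℝ (connectionMatrix G v) x u =
      R⁻¹ * fderiv ℝ (connectionMatrix G (R *ᵥ v)) (R *ᵥ x) (R *ᵥ u) * R := by
    have heq : connectionMatrix G v =ᶠ[𝓝 x] _ := hnear.mono fun y hy => hy v
    rw [heq.fderiv_eq, fderiv_mul_comp_mulVec_mul]
    exact (contDiffAt_connectionMatrix hG.self_of_nhds.1 hG.self_of_nhds.2 _).differentiableAt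
      (by simp)
  have hcancel (A B : Matrix ι ι ℝ) : R⁻¹ * A * R * (R⁻¹ * B * R) = R⁻¹ * (A * B) * R := by
    simp only [mul_assoc, Matrix.mul_nonsing_inv_cancel_left _ _ hR]
  simp only [curvatureMatrix, hderiv, hnear.self_of_nhds, hcancel, mul_add, mul_sub, add_mul,
    sub_mul]

lemma ricci_eq_sum_curvatureMatrix (hG : ∀ i j, ContDiffAt ℝ ∞ (fun y => G y i j) x)
    (hdet : IsUnit (G x).det) (hsymm : ∀ᶠ y in 𝓝 x, (G y).IsSymm) (i j : ι) :
    ricci G x i j = ∑ k, curvatureMatrix G (Pi.single k 1) (Pi.single j 1) x k i := by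
  have hentry (k j i : ι) (y : ι → ℝ) :
      connectionMatrix G (Pi.single i 1) y k j = christoffel G k i j y := by
    simp [connectionMatrix, Pi.single_apply]
  have hderiv (k l i j : ι) : fderiv ℝ (connectionMatrix G (Pi.single i 1)) x (Pi.single l 1) k j =
      pderiv l (christoffel G k i j) x := by
    rw [fderiv_matrix_apply ((contDiffAt_connectionMatrix hG hdet _).differentiableAt (by simp))]
    simp only [hentry]
    rfl
  have hcomm (k i j : ι) : christoffel G k i j =ᶠ[𝓝 x] christoffel G k j i :=
    hsymm.eventually_nhds.mono fun y hy => christoffel_comm hy k i j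
  have hpderiv (k i j l : ι) : pderiv l (christoffel G k i j) x =
      pderiv l (christoffel G k j i) x := by
    rw [pderiv, pderiv, (hcomm k i j).fderiv_eq]
  simp only [ricci, curvatureMatrix, Matrix.add_apply, Matrix.sub_apply, Matrix.mul_apply, hderiv,
    hentry, Finset.sum_add_distrib, Finset.sum_sub_distrib, hpderiv _ i]
  simp only [fun k l => (hcomm k i l).self_of_nhds]

lemma curvatureMatrix_eq_sum (hG : ∀ i j, ContDiffAt ℝ ∞ (fun y => G y i j) x)
    (hdet : IsUnit (G x).det) (u v : ι → ℝ) : curvatureMatrix G u v x =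
      ∑ a, ∑ b, (u a * v b) • curvatureMatrix G (Pi.single a 1) (Pi.single b 1) x := by
  have hdiff (v : ι → ℝ) : DifferentiableAt ℝ (connectionMatrix G v) x :=
    (contDiffAt_connectionMatrix hG hdet v).differentiableAt (by simp)
  have hconn (v : ι → ℝ) : connectionMatrix G v =
      ∑ b, v b • connectionMatrix G (Pi.single b 1) := by
    ext y k j
    simp [connectionMatrix, Matrix.sum_apply, Pi.single_apply]
  have hderiv (u v : ι → ℝ) : fderiv ℝ (connectionMatrix G v) x u =
      ∑ a, ∑ b, (u a * v b) • fderiv ℝ (connectionMatrix G (Pi.single b 1)) x (Pi.single a 1) := by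
    have hsum : HasFDerivAt (connectionMatrix G v)
        (∑ b, v b • fderiv ℝ (connectionMatrix G (Pi.single b 1)) x) x := by
      rw [hconn v]
      exact HasFDerivAt.sum fun b _ => (hdiff _).hasFDerivAt.const_smul (v b)
    conv_lhs => rw [pi_eq_sum_univ' u, hsum.fderiv, map_sum]
    refine Finset.sum_congr rfl fun a _ => ?_
    simp only [map_smul, sum_apply, smul_apply,
      Finset.smul_sum, smul_smul]
  have hmul (u v : ι → ℝ) : connectionMatrix G u x * connectionMatrix G v x = ∑ a, ∑ b,
      (u a * v b) • (connectionMatrix G (Pi.single a 1) x *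
        connectionMatrix G (Pi.single b 1) x) := by
    conv_lhs => rw [hconn u, hconn v]
    simp only [Finset.sum_apply, Pi.smul_apply, Finset.sum_mul_sum, smul_mul_smul_comm]
  rw [curvatureMatrix, hderiv u v, hderiv v u, hmul u v, hmul v u, Finset.sum_comm (s := .univ)
    (f := fun a b => (v a * u b) • fderiv ℝ _ x _), Finset.sum_comm (s := .univ)
    (f := fun a b => (v a * u b) • (_ * _))]
  simp only [curvatureMatrix, smul_add, smul_sub, Finset.sum_add_distrib, Finset.sum_sub_distrib,
    mul_comm]

lemma ricci_eq_of_isometry {U : Set (ι → ℝ)} (hU : IsOpen U)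
    (hG : ∀ i j, ContDiffOn ℝ ∞ (fun y => G y i j) U) (hpos : ∀ y ∈ U, (G y).PosDef)
    (hR : IsUnit R.det) (hRU : ∀ y ∈ U, R *ᵥ y ∈ U) (hGR : ∀ y ∈ U, G y = Rᵀ * G (R *ᵥ y) * R)
    (hx : x ∈ U) : Matrix.of (ricci G x) = Rᵀ * Matrix.of (ricci G (R *ᵥ x)) * R := by
  have hsmooth {y : ι → ℝ} (hy : y ∈ U) (i j : ι) : ContDiffAt ℝ ∞ (fun z => G z i j) y :=
    (hG i j).contDiffAt (hU.mem_nhds hy)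
  have hdet {y : ι → ℝ} (hy : y ∈ U) : IsUnit (G y).det := (hpos y hy).det_pos.ne'.isUnit
  have hsymm {y : ι → ℝ} (hy : y ∈ U) : ∀ᶠ z in 𝓝 y, (G z).IsSymm := by
    filter_upwards [hU.mem_nhds hy] with z hz using (hpos z hz).isHermitian
  have hcurv (u v : ι → ℝ) := curvatureMatrix_eq_of_isometry hR
    (by filter_upwards [hU.mem_nhds (hRU x hx)] with y hy using ⟨hsmooth hy, hdet hy⟩)
    (by filter_upwards [hU.mem_nhds hx] with y hy using hGR y hy) u v
  ext i j
  rw [Matrix.of_apply, ricci_eq_sum_curvatureMatrix (hsmooth hx) (hdet hx) (hsymm hx)]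
  let K (a b : ι) := curvatureMatrix G (Pi.single a 1) (Pi.single b 1) (R *ᵥ x)
  have htrace (a b : ι) : ∑ k, R a k * (R⁻¹ * K a b * R) k i = ∑ c, K a b a c * R c i := by
    rw [← Matrix.mul_apply, ← Matrix.mul_apply, mul_assoc,
      Matrix.mul_nonsing_inv_cancel_left _ _ hR]
  calc ∑ k, curvatureMatrix G (Pi.single k 1) (Pi.single j 1) x k i
      = ∑ k, ∑ a, ∑ b, R a k * R b j * (R⁻¹ * K a b * R) k i := by
        refine Finset.sum_congr rfl fun k _ => ?_
        rw [hcurv, curvatureMatrix_eq_sum (hsmooth (hRU x hx)) (hdet (hRU x hx))]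
        simp only [Finset.mul_sum, Finset.sum_mul, Matrix.mul_smul, Matrix.smul_mul,
          Matrix.sum_apply, Matrix.smul_apply, smul_eq_mul, Matrix.mulVec_single_one,
          Matrix.col_apply, K]
    _ = ∑ b, R b j * ∑ a, ∑ k, R a k * (R⁻¹ * K a b * R) k i := by
        simp only [Finset.mul_sum]
        rw [Finset.sum_comm, Finset.sum_congr rfl fun a _ => Finset.sum_comm, Finset.sum_comm]
        refine Finset.sum_congr rfl fun b _ => Finset.sum_congr rfl fun a _ =>
          Finset.sum_congr rfl fun k _ => by ring
    _ = _ := by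
        simp only [htrace]
        simp only [Matrix.mul_apply, Matrix.transpose_apply, Matrix.of_apply, Finset.sum_mul,
          Finset.mul_sum,
          ricci_eq_sum_curvatureMatrix (hsmooth (hRU x hx)) (hdet (hRU x hx)) (hsymm (hRU x hx))]
        refine Finset.sum_congr rfl fun b _ => ?_
        rw [Finset.sum_comm]
        refine Finset.sum_congr rfl fun c _ => Finset.sum_congr rfl fun a _ => by ring

end Isometry

/-! ### Contraction of the covariant derivative with a null geodesic field -/

section Contract

variable {n : ℕ} {v : Fin 3 → ℂ} {c : ℂ}

lemma contract_sum_mul_update {A : Matrix (Fin 3) (Fin 3) ℂ} (hA : Matrix.mulVec A v = c • v)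
    (T : Tensor (Fin 3) ℂ n) (k : Fin n) :
    contract v (fun I => ∑ j, A j (I k) * T (Function.update I k j)) = c * contract v T := by
  have hprod (I : Fin n → Fin 3) (i : Fin 3) : ∏ l, v (Function.update I k i l) =
      v i * ∏ l ∈ Finset.univ \ {k}, v (I l) := by
    rw [← Finset.prod_update_of_mem (Finset.mem_univ k) (fun l => v (I l)) (v i)]
    exact Finset.prod_congr rfl fun l _ => congrFun (Function.comp_update v I k i) l
  calc contract v (fun I => ∑ j, A j (I k) * T (Function.update I k j))
      = ∑ I, ∑ j, (∏ l, v (I l)) * (A j (I k) * T (Function.update I k j)) := by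
        simp only [contract, Finset.mul_sum]
    _ = ∑ I, ∑ i, (∏ l, v (Function.update I k i l)) * (A (I k) i * T I) := by
        rw [← sum_sum_update_apply k]
        simp only [Function.update_idem, Function.update_self, Function.update_eq_self]
    _ = ∑ I, Matrix.mulVec A v (I k) * ((∏ l ∈ Finset.univ \ {k}, v (I l)) * T I) := by
        refine Finset.sum_congr rfl fun I _ => ?_
        simp only [hprod, Matrix.mulVec, dotProduct, Finset.sum_mul]
        exact Finset.sum_congr rfl fun i _ => by ring
    _ = c * contract v T := by
        simp only [contract, Finset.mul_sum, hA, Pi.smul_apply, smul_eq_mul]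
        refine Finset.sum_congr rfl fun I _ => ?_
        rw [← Function.update_eq_self k I, hprod, Function.update_eq_self]
        ring

variable {T : (Fin 3 → ℝ) → Tensor (Fin 3) ℂ n} {x : Fin 3 → ℝ}

lemma contract_pderiv (hT : ∀ I, DifferentiableAt ℝ (fun y => T y I) x) (v : Fin 3 → ℂ)
    (i : Fin 3) : contract v (fun I => pderiv i (fun y => T y I) x) =
      pderiv i (fun y => contract v (T y)) x := by
  simp only [contract, pderiv]
  rw [fderiv_fun_sum fun I _ => (hT I).const_mul _, sum_apply]
  exact Finset.sum_congr rfl fun I _ => by rw [fderiv_const_mul (hT I)]; rfl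

lemma contract_covDeriv {G : (Fin 3 → ℝ) → Matrix (Fin 3) (Fin 3) ℝ}
    (hT : ∀ I, DifferentiableAt ℝ (fun y => T y I) x)
    (hΓ : ∀ k, ∑ i, ∑ j, (christoffel G k i j x : ℂ) * (v i * v j) = c * v k) :
    contract v (covDeriv G T x) =
      ∑ i, v i * pderiv i (fun y => contract v (T y)) x - n * c * contract v (T x) := by
  let A : Matrix (Fin 3) (Fin 3) ℂ := Matrix.of fun j m => ∑ i, v i * christoffel G j i m x
  have hA : Matrix.mulVec A v = c • v := by
    funext j
    rw [Pi.smul_apply, smul_eq_mul, ← hΓ j, Finset.sum_comm]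
    simp only [A, Matrix.mulVec, dotProduct, Matrix.of_apply, Finset.sum_mul]
    exact Finset.sum_congr rfl fun m _ => Finset.sum_congr rfl fun i _ => by ring
  have hfirst : contractFirst v (covDeriv G T x) =
      (∑ i, v i • fun I => pderiv i (fun y => T y I) x) -
        ∑ k : Fin n, fun I => ∑ j, A j (I k) * T x (Function.update I k j) := by
    funext I
    simp only [contractFirst_apply, covDeriv, Fin.cons_zero, Fin.tail_cons, mul_sub,
      Finset.sum_sub_distrib, Pi.sub_apply, Finset.sum_apply, Pi.smul_apply, smul_eq_mul]
    congr 1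
    simp only [A, Matrix.of_apply, Complex.real_smul, Finset.mul_sum, Finset.sum_mul]
    rw [Finset.sum_comm]
    refine Finset.sum_congr rfl fun k _ => ?_
    rw [Finset.sum_comm]
    exact Finset.sum_congr rfl fun j _ => Finset.sum_congr rfl fun i _ => by ring
  rw [contract_succ, hfirst, contract_sub, contract_sum, contract_sum]
  simp only [contract_smul, contract_pderiv hT, contract_sum_mul_update hA, Finset.sum_const,
    Finset.card_univ, Fintype.card_fin, nsmul_eq_mul, mul_assoc]

end Contract

section NullGeodesic

open scoped Matrix Topology

variable {ι : Type} [Fintype ι] {S : Matrix ι ι ℝ}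

lemma sum_sum_mul_eq_zero_of_transpose_eq_neg (hS : Sᵀ = -S) (v : ι → ℂ) :
    ∑ i, v i * ∑ j, (S j i : ℂ) * v j = 0 := by
  have hanti (i j : ι) : S i j = -S j i := congrFun (congrFun hS j) i
  refine self_eq_neg.1 ?_
  simp only [Finset.mul_sum, ← Finset.sum_neg_distrib]
  rw [Finset.sum_comm]
  exact Finset.sum_congr rfl fun i _ => Finset.sum_congr rfl fun j _ => by
    rw [hanti]
    push_cast
    ring

variable [DecidableEq ι] {G : (ι → ℝ) → Matrix ι ι ℝ} {x : ι → ℝ}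

lemma sum_christoffel_eq (hdet : IsUnit (G x).det) {v : ι → ℂ} {c : ℂ}
    (h : ∀ l, ∑ i, ∑ j, ((2 * pderiv i (fun y => G y l j) x -
      pderiv l (fun y => G y i j) x : ℝ) : ℂ) * (v i * v j) = 2 * c * ∑ m, (G x l m : ℂ) * v m)
    (k : ι) : ∑ i, ∑ j, (christoffel G k i j x : ℂ) * (v i * v j) = c * v k := by
  let a (k : ι) : ℂ := ∑ i, ∑ j, (christoffel G k i j x : ℂ) * (v i * v j)
  let GC := (G x).map Complex.ofReal
  have hGC : IsUnit GC.det := by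
    change IsUnit (Complex.ofRealHom.mapMatrix (G x)).det
    rw [← RingHom.map_det]
    exact hdet.map Complex.ofRealHom
  suffices hG : GC *ᵥ a = GC *ᵥ (c • v) from
    congrFun (Matrix.mulVec_injective_of_isUnit ((Matrix.isUnit_iff_isUnit_det _).2 hGC) hG) k
  funext l
  have hswap : ∑ i, ∑ j, ((pderiv j (fun y => G y l i) x : ℝ) : ℂ) * (v i * v j) =
      ∑ i, ∑ j, ((pderiv i (fun y => G y l j) x : ℝ) : ℂ) * (v i * v j) := by
    rw [Finset.sum_comm]
    exact Finset.sum_congr rfl fun i _ => Finset.sum_congr rfl fun j _ => by ring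
  calc (GC *ᵥ a) l = ∑ i, ∑ j, ((∑ k, G x l k * christoffel G k i j x : ℝ) : ℂ) * (v i * v j) := by
        simp only [GC, a, Matrix.mulVec, dotProduct, Matrix.map_apply, Finset.mul_sum,
          Complex.ofReal_sum, Complex.ofReal_mul, Finset.sum_mul, ← mul_assoc]
        rw [Finset.sum_comm]
        exact Finset.sum_congr rfl fun i _ => Finset.sum_comm
    _ = (1 / 2) * ∑ i, ∑ j, ((2 * pderiv i (fun y => G y l j) x -
          pderiv l (fun y => G y i j) x : ℝ) : ℂ) * (v i * v j) := by
        simp only [sum_mul_christoffel hdet]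
        push_cast
        simp only [mul_assoc, ← Finset.mul_sum, add_mul, sub_mul, two_mul, Finset.sum_add_distrib,
          Finset.sum_sub_distrib, hswap]
    _ = (GC *ᵥ (c • v)) l := by
        rw [h, Matrix.mulVec_smul]
        simp only [GC, Matrix.mulVec, dotProduct, Matrix.map_apply, Pi.smul_apply, smul_eq_mul]
        ring

variable {κ B : (ι → ℝ) → ℝ}

lemma pderiv_of_eventuallyEq_exp_smul (hκ : DifferentiableAt ℝ κ x) (hB : DifferentiableAt ℝ B x)
    (hG : G =ᶠ[𝓝 x] fun y => Real.exp (2 * κ y) • (1 + B y • Matrix.vecMulVec (S *ᵥ y) (S *ᵥ y)))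
    (l i j : ι) : pderiv l (fun y => G y i j) x = 2 * pderiv l κ x * G x i j +
      Real.exp (2 * κ x) * (pderiv l B x * ((S *ᵥ x) i * (S *ᵥ x) j) +
        B x * (S i l * (S *ᵥ x) j + (S *ᵥ x) i * S j l)) := by
  have hentry : (fun y => G y i j) =ᶠ[𝓝 x] fun y => Real.exp (2 * κ y) *
      ((1 : Matrix ι ι ℝ) i j + B y * ((S *ᵥ y) i * (S *ᵥ y) j)) :=
    hG.mono fun y hy => congrFun (congrFun hy i) j
  have hS (i : ι) : HasFDerivAt (fun y => (S *ᵥ y) i)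
      ((ContinuousLinearMap.proj i).comp S.mulVecLin.toContinuousLinearMap) x :=
    ((ContinuousLinearMap.proj i).comp S.mulVecLin.toContinuousLinearMap).hasFDerivAt
  have hSl (i : ι) : ((ContinuousLinearMap.proj i).comp S.mulVecLin.toContinuousLinearMap)
      (Pi.single l (1 : ℝ)) = S i l := by simp
  have hderiv : HasFDerivAt (fun y => Real.exp (2 * κ y) *
      ((1 : Matrix ι ι ℝ) i j + B y * ((S *ᵥ y) i * (S *ᵥ y) j))) _ x :=
    ((hκ.hasFDerivAt.const_mul 2).exp).mul ((hB.hasFDerivAt.mul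
      ((hS i).mul (hS j))).const_add ((1 : Matrix ι ι ℝ) i j))
  have hGx : G x i j = _ := hentry.self_of_nhds
  rw [pderiv, hentry.fderiv_eq, HasFDerivAt.fderiv hderiv, hGx]
  simp only [add_apply, smul_apply, smul_eq_mul, pderiv, Pi.mul_apply, hSl]
  ring

lemma sum_mul_of_eq_exp_smul {H : Matrix ι ι ℝ} {k b : ℝ} {w : ι → ℝ} {v : ι → ℂ}
    (hH : H = Real.exp k • (1 + b • Matrix.vecMulVec w w)) (hw : ∑ i, (w i : ℂ) * v i = 0) (l : ι) :
    ∑ m, (H l m : ℂ) * v m = Real.exp k * v l := by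
  have hentry (m : ι) : (H l m : ℂ) * v m =
      Real.exp k * ((if l = m then v m else 0) + b * w l * (w m * v m)) := by
    simp only [hH, Matrix.smul_apply, Matrix.add_apply, Matrix.one_apply, Matrix.vecMulVec_apply,
      smul_eq_mul]
    split_ifs <;> push_cast <;> ring
  simp only [hentry, ← Finset.mul_sum, Finset.sum_add_distrib, hw, Finset.sum_ite_eq,
    Finset.mem_univ, if_true, mul_zero, add_zero]

lemma sum_christoffel_eq_of_eventuallyEq_exp_smul (hdet : IsUnit (G x).det)
    (hκ : DifferentiableAt ℝ κ x) (hB : DifferentiableAt ℝ B x) (hS : Sᵀ = -S)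
    (hG : G =ᶠ[𝓝 x] fun y => Real.exp (2 * κ y) • (1 + B y • Matrix.vecMulVec (S *ᵥ y) (S *ᵥ y)))
    {v : ι → ℂ} (hv : ∑ i, v i * v i = 0) (hSv : ∑ i, ((S *ᵥ x) i : ℂ) * v i = 0) (k : ι) :
    ∑ i, ∑ j, (christoffel G k i j x : ℂ) * (v i * v j) =
      2 * (∑ i, v i * ((pderiv i κ x : ℝ) : ℂ)) * v k := by
  have hGv := sum_mul_of_eq_exp_smul hG.self_of_nhds hSv
  have hdGv (l i : ι) : ∑ j, ((pderiv l (fun y => G y i j) x : ℝ) : ℂ) * v j =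
      Real.exp (2 * κ x) * (2 * ((pderiv l κ x : ℝ) : ℂ) * v i +
        B x * (S *ᵥ x) i * ∑ j, (S j l : ℂ) * v j) := by
    have hterm (j : ι) : ((pderiv l (fun y => G y i j) x : ℝ) : ℂ) * v j =
        2 * ((pderiv l κ x : ℝ) : ℂ) * (G x i j * v j) +
          Real.exp (2 * κ x) * (((pderiv l B x : ℝ) : ℂ) * (S *ᵥ x) i + B x * S i l) *
            ((S *ᵥ x) j * v j) +
          Real.exp (2 * κ x) * (B x * (S *ᵥ x) i) * (S j l * v j) := by
      rw [pderiv_of_eventuallyEq_exp_smul hκ hB hG]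
      push_cast
      ring
    simp only [hterm, Finset.sum_add_distrib, ← Finset.mul_sum, hGv, hSv]
    ring
  refine sum_christoffel_eq hdet (fun l => ?_) k
  calc _ = 2 * ∑ i, v i * ∑ j, ((pderiv i (fun y => G y l j) x : ℝ) : ℂ) * v j -
        ∑ i, v i * ∑ j, ((pderiv l (fun y => G y i j) x : ℝ) : ℂ) * v j := by
        simp only [Finset.mul_sum, ← Finset.sum_sub_distrib]
        exact Finset.sum_congr rfl fun i _ => Finset.sum_congr rfl fun j _ => by push_cast; ring
    _ = Real.exp (2 * κ x) * (4 * (∑ i, v i * ((pderiv i κ x : ℝ) : ℂ)) * v l +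
          2 * B x * (S *ᵥ x) l * ∑ i, v i * ∑ j, (S j i : ℂ) * v j -
          2 * ((pderiv l κ x : ℝ) : ℂ) * (∑ i, v i * v i) -
          B x * (∑ j, (S j l : ℂ) * v j) * ∑ i, ((S *ᵥ x) i : ℂ) * v i) := by
        simp only [hdGv]
        generalize hs : (fun i => ∑ j, (S j i : ℂ) * v j) = s
        simp only [funext_iff] at hs
        simp only [hs, Finset.mul_sum, Finset.sum_mul, ← Finset.sum_sub_distrib,
          ← Finset.sum_add_distrib]
        exact Finset.sum_congr rfl fun i _ => by ring
    _ = _ := by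
        rw [sum_sum_mul_eq_zero_of_transpose_eq_neg hS, hv, hSv, hGv]
        ring

end NullGeodesic

/-! ### Meridian planes and the fields `η` and `∂/∂φ` -/

section Meridian

open scoped Matrix

lemma isLinearMap_meridian (α : ℝ) : IsLinearMap ℝ (meridian α) where
  map_add p q := by
    funext i
    fin_cases i <;> simp [meridian, add_mul]
  map_smul c q := by
    funext i
    fin_cases i <;> simp [meridian, mul_assoc]

lemma meridian_zero (α : ℝ) : meridian α (0, 0) = 0 :=
  (isLinearMap_meridian α).map_zero

lemma hasFDerivAt_meridian (α : ℝ) (q : ℝ × ℝ) :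
    HasFDerivAt (meridian α) ((isLinearMap_meridian α).mk' _).toContinuousLinearMap q :=
  ((isLinearMap_meridian α).mk' _).toContinuousLinearMap.hasFDerivAt

lemma contDiff_meridian (α : ℝ) : ContDiff ℝ ∞ (meridian α) :=
  ((isLinearMap_meridian α).mk' _).toContinuousLinearMap.contDiff

variable {U : Set (Fin 3 → ℝ)} {α : ℝ}

lemma mapsTo_meridian : Set.MapsTo (meridian α) (meridianDomain U α) U := fun _ hq => hq

lemma isOpen_meridianDomain (hU : IsOpen U) (α : ℝ) : IsOpen (meridianDomain U α) :=
  hU.preimage (contDiff_meridian α).continuous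

lemma continuousOn_comp_meridian {X : Type*} [TopologicalSpace X] {F : (Fin 3 → ℝ) → X}
    (hF : ContinuousOn F U) : ContinuousOn (fun q => F (meridian α q)) (meridianDomain U α) :=
  hF.comp (contDiff_meridian α).continuous.continuousOn mapsTo_meridian

lemma exists_meridian_eq (x : Fin 3 → ℝ) : ∃ α q, meridian α q = x := by
  let w : ℂ := ⟨x 0, x 1⟩
  refine ⟨w.arg, (x 2, ‖w‖), ?_⟩
  funext i
  fin_cases i
  · exact Complex.norm_mul_cos_arg w
  · exact Complex.norm_mul_sin_arg w
  · rfl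

lemma eqOn_meridianDomain_of_ne {X : Type*} [TopologicalSpace X] [T2Space X] (hU : IsOpen U)
    {F H : ℝ × ℝ → X} (hF : ContinuousOn F (meridianDomain U α))
    (hH : ContinuousOn H (meridianDomain U α))
    (h : ∀ q ∈ meridianDomain U α, q.2 ≠ 0 → F q = H q) : Set.EqOn F H (meridianDomain U α) := by
  have hdense : Dense {q : ℝ × ℝ | q.2 ≠ 0} :=
    (dense_compl_singleton (0 : ℝ)).preimage isOpenMap_snd
  exact Set.EqOn.of_subset_closure (s := meridianDomain U α ∩ {q | q.2 ≠ 0})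
    (fun q hq => h q hq.1 hq.2) hF hH Set.inter_subset_left
    (hdense.open_subset_closure_inter (isOpen_meridianDomain hU α))

lemma pderiv_ofReal {ι : Type} [Fintype ι] [DecidableEq ι] {f : (ι → ℝ) → ℝ} {x : ι → ℝ}
    (hf : DifferentiableAt ℝ f x) (i : ι) :
    pderiv i (fun y => (f y : ℂ)) x = ((pderiv i f x : ℝ) : ℂ) := by
  have hderiv : HasFDerivAt (fun y => (f y : ℂ)) (Complex.ofRealCLM.comp (fderiv ℝ f x)) x :=
    Complex.ofRealCLM.hasFDerivAt.comp x hf.hasFDerivAt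
  rw [pderiv, hderiv.fderiv]
  rfl

lemma etaD_comp_meridian {F : (Fin 3 → ℝ) → ℂ} {q : ℝ × ℝ}
    (hF : DifferentiableAt ℝ F (meridian α q)) :
    etaD (fun q' => F (meridian α q')) q = ∑ i, eta α i * pderiv i F (meridian α q) := by
  have hcomp (u : ℝ × ℝ) : fderiv ℝ (fun q' => F (meridian α q')) q u =
      fderiv ℝ F (meridian α q) (meridian α u) := by
    have hderiv : HasFDerivAt (fun q' => F (meridian α q')) _ q :=
      hF.hasFDerivAt.comp q (hasFDerivAt_meridian α q)
    rw [hderiv.fderiv]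
    rfl
  have hsum (u : Fin 3 → ℝ) : fderiv ℝ F (meridian α q) u =
      ∑ i, (u i : ℂ) * pderiv i F (meridian α q) := by
    conv_lhs => rw [pi_eq_sum_univ' u]
    simp only [map_sum, map_smul, pderiv, Complex.real_smul]
  rw [etaD, hcomp, hcomp, hsum, hsum]
  simp [Fin.sum_univ_three, meridian, eta]
  ring

lemma etaD_congr {F H : ℝ × ℝ → ℂ} {s : Set (ℝ × ℝ)} (hs : IsOpen s) (h : Set.EqOn F H s)
    {q : ℝ × ℝ} (hq : q ∈ s) : etaD F q = etaD H q := by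
  rw [etaD, etaD, (h.eventuallyEq_of_mem (hs.mem_nhds hq)).fderiv_eq]

lemma sum_eta_mul_eta (α : ℝ) : ∑ i, eta α i * eta α i = 0 := by
  simp only [eta, Fin.sum_univ_three, Matrix.cons_val_zero, Matrix.cons_val_one, Matrix.cons_val]
  push_cast
  linear_combination Complex.I * Complex.I * Complex.sin_sq_add_cos_sq α + Complex.I_mul_I

/-- The unit vector in the direction of `∂/∂φ` along the meridian plane at angle `α`. -/
noncomputable def phiHat (α : ℝ) : Fin 3 → ℝ := ![-Real.sin α, Real.cos α, 0]

lemma sum_phiHat_mul_eta (α : ℝ) : ∑ i, (phiHat α i : ℂ) * eta α i = 0 := by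
  simp [phiHat, eta, Fin.sum_univ_three]
  ring

/-- The infinitesimal generator of the rotations `rot α`: the Killing field `∂/∂φ` at `x` is
`rotGenerator *ᵥ x`. -/
def rotGenerator : Matrix (Fin 3) (Fin 3) ℝ := !![0, -1, 0; 1, 0, 0; 0, 0, 0]

lemma transpose_rotGenerator : rotGeneratorᵀ = -rotGenerator := by
  ext i j
  fin_cases i <;> fin_cases j <;> simp [rotGenerator]

lemma rotGenerator_mulVec (x : Fin 3 → ℝ) : rotGenerator *ᵥ x = ![-x 1, x 0, 0] := by
  funext i
  fin_cases i <;> simp [rotGenerator, Matrix.mulVec, dotProduct, Fin.sum_univ_three]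

lemma rotGenerator_mulVec_meridian (α : ℝ) (q : ℝ × ℝ) :
    rotGenerator *ᵥ meridian α q = q.2 • phiHat α := by
  rw [rotGenerator_mulVec]
  funext i
  fin_cases i <;> simp [meridian, phiHat]

lemma rho_sq (x : Fin 3 → ℝ) : rho x ^ 2 = x 0 ^ 2 + x 1 ^ 2 := Real.sq_sqrt (by positivity)

lemma rho_meridian_sq (α : ℝ) (q : ℝ × ℝ) : rho (meridian α q) ^ 2 = q.2 ^ 2 := by
  simp only [rho_sq, meridian, Matrix.cons_val_zero, Matrix.cons_val_one]
  linear_combination q.2 ^ 2 * Real.sin_sq_add_cos_sq α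

lemma rho_meridian_ne_zero {q : ℝ × ℝ} (hq : q.2 ≠ 0) : rho (meridian α q) ≠ 0 := by
  rw [← pow_ne_zero_iff two_ne_zero, rho_meridian_sq]
  exact pow_ne_zero 2 hq

lemma dPhi_eq_smul (x : Fin 3 → ℝ) : dPhi x = (rho x ^ 2)⁻¹ • (rotGenerator *ᵥ x) := by
  rw [rotGenerator_mulVec]
  funext i
  fin_cases i <;> simp [dPhi, div_eq_inv_mul]

lemma vecMulVec_dRho_add_vecMulVec_dZ {x : Fin 3 → ℝ} (hx : rho x ≠ 0) :
    Matrix.vecMulVec (dRho x) (dRho x) + Matrix.vecMulVec dZ dZ =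
      1 - (rho x ^ 2)⁻¹ • Matrix.vecMulVec (rotGenerator *ᵥ x) (rotGenerator *ᵥ x) := by
  have hsq := rho_sq x
  rw [rotGenerator_mulVec]
  ext i j
  fin_cases i <;> fin_cases j <;> simp [dRho, dZ] <;> field_simp <;> linarith

end Meridian

/-! ### Axisymmetric metrics -/

lemma zero_mem_meridianDomain {U : Set (Fin 3 → ℝ)} (hU : 0 ∈ U) (α : ℝ) :
    (0, 0) ∈ meridianDomain U α := by
  change meridian α (0, 0) ∈ U
  rwa [meridian_zero]

lemma vecMulVec_smul_smul {ι : Type*} (c : ℝ) (v : ι → ℝ) :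
    Matrix.vecMulVec (c • v) (c • v) = c ^ 2 • Matrix.vecMulVec v v := by
  rw [Matrix.smul_vecMulVec, Matrix.vecMulVec_smul, smul_smul, sq]

/-- `G` is a smooth Riemannian metric on the open axisymmetric region `U` of the form
`e^{2κ} (ρ̃² e^{-2β} dφ² + dρ̃² + dz̃²)` with smooth axisymmetric `κ` and `β`. The form is required
off the axis only, where `dφ` and `dρ̃` are defined. -/
structure IsAxisymmetricMetric (U : Set (Fin 3 → ℝ))
    (G : (Fin 3 → ℝ) → Matrix (Fin 3) (Fin 3) ℝ) (κ β : (Fin 3 → ℝ) → ℝ) : Prop where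
  isOpen : IsOpen U
  domain : ∀ α, ∀ x ∈ U, (rot α).mulVec x ∈ U
  smooth : ∀ i j, ContDiffOn ℝ ∞ (fun x => G x i j) U
  posDef : ∀ x ∈ U, (G x).PosDef
  κ_smooth : ContDiffOn ℝ ∞ κ U
  κ_inv : ∀ α, ∀ x ∈ U, κ ((rot α).mulVec x) = κ x
  β_smooth : ContDiffOn ℝ ∞ β U
  β_inv : ∀ α, ∀ x ∈ U, β ((rot α).mulVec x) = β x
  form : ∀ x ∈ U, rho x ≠ 0 → G x = Real.exp (2 * κ x) •
    ((rho x ^ 2 * Real.exp (-2 * β x)) • Matrix.vecMulVec (dPhi x) (dPhi x) +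
      Matrix.vecMulVec (dRho x) (dRho x) + Matrix.vecMulVec dZ dZ)

namespace IsAxisymmetricMetric

open scoped Matrix Topology

variable {U : Set (Fin 3 → ℝ)} {G : (Fin 3 → ℝ) → Matrix (Fin 3) (Fin 3) ℝ}
  {κ β : (Fin 3 → ℝ) → ℝ} (hG : IsAxisymmetricMetric U G κ β)

include hG

lemma eq_of_rho_ne_zero {x : Fin 3 → ℝ} (hx : x ∈ U) (hρ : rho x ≠ 0) :
    G x = Real.exp (2 * κ x) • (1 + ((Real.exp (-2 * β x) - 1) / rho x ^ 2) •
      Matrix.vecMulVec (rotGenerator *ᵥ x) (rotGenerator *ᵥ x)) := by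
  rw [hG.form x hx hρ, add_assoc, vecMulVec_dRho_add_vecMulVec_dZ hρ, dPhi_eq_smul,
    vecMulVec_smul_smul]
  congr 1
  match_scalars <;> field_simp
  ring

lemma differentiableAt_κ {x : Fin 3 → ℝ} (hx : x ∈ U) : DifferentiableAt ℝ κ x :=
  (hG.κ_smooth.contDiffAt (hG.isOpen.mem_nhds hx)).differentiableAt (by simp)

lemma eq_meridian (α : ℝ) {q : ℝ × ℝ} (hq : q ∈ meridianDomain U α) :
    G (meridian α q) = Real.exp (2 * κ (meridian α q)) •
      (1 + (Real.exp (-2 * β (meridian α q)) - 1) • Matrix.vecMulVec (phiHat α) (phiHat α)) := by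
  have hκ := continuousOn_comp_meridian (α := α) hG.κ_smooth.continuousOn
  have hβ := continuousOn_comp_meridian (α := α) hG.β_smooth.continuousOn
  have hGc : ContinuousOn G U :=
    continuousOn_pi.2 fun i => continuousOn_pi.2 fun j => (hG.smooth i j).continuousOn
  refine eqOn_meridianDomain_of_ne hG.isOpen (F := fun q => G (meridian α q))
    (H := fun q => Real.exp (2 * κ (meridian α q)) •
      (1 + (Real.exp (-2 * β (meridian α q)) - 1) • Matrix.vecMulVec (phiHat α) (phiHat α)))
    (continuousOn_comp_meridian hGc) ?_ (fun q hq hne => ?_) hq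
  · exact (Real.continuous_exp.comp_continuousOn (continuousOn_const.mul hκ)).smul
      (continuousOn_const.add (((Real.continuous_exp.comp_continuousOn
        (continuousOn_const.mul hβ)).sub continuousOn_const).smul continuousOn_const))
  · rw [hG.eq_of_rho_ne_zero hq (rho_meridian_ne_zero hne), rho_meridian_sq,
      rotGenerator_mulVec_meridian, vecMulVec_smul_smul, smul_smul,
      div_mul_cancel₀ _ (pow_ne_zero 2 hne)]

lemma apply_zero (h0 : 0 ∈ U) : G 0 = Real.exp (2 * κ 0) • 1 := by
  have hG₀ := hG.eq_meridian 0 (zero_mem_meridianDomain h0 0)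
  have hG₁ := hG.eq_meridian (Real.pi / 2) (zero_mem_meridianDomain h0 _)
  rw [meridian_zero] at hG₀ hG₁
  have hβ : Real.exp (-2 * β 0) - 1 = 0 := by
    have h := congrFun (congrFun (hG₁.symm.trans hG₀) 0) 0
    simpa [phiHat, sub_eq_zero] using h
  rw [hG₀, hβ, zero_smul, add_zero]

lemma eta_null (α : ℝ) {q : ℝ × ℝ} (hq : q ∈ meridianDomain U α) :
    ∑ i, ∑ j, ((G (meridian α q) i j : ℝ) : ℂ) * (eta α i * eta α j) = 0 := by
  have hHη := sum_mul_of_eq_exp_smul (hG.eq_meridian α hq) (sum_phiHat_mul_eta α)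
  calc _ = ∑ i, eta α i * ∑ j, ((G (meridian α q) i j : ℝ) : ℂ) * eta α j := by
        simp only [Finset.mul_sum, mul_left_comm]
    _ = Real.exp (2 * κ (meridian α q)) * ∑ i, eta α i * eta α i := by
        simp only [hHη, Finset.mul_sum, mul_left_comm]
    _ = 0 := by rw [sum_eta_mul_eta, mul_zero]

lemma contract_stfPart (α : ℝ) {q : ℝ × ℝ} (hq : q ∈ meridianDomain U α) {n : ℕ}
    (T : Tensor (Fin 3) ℂ n) :
    contract (eta α) (stfPart (G (meridian α q)) T) = contract (eta α) T :=
  (isSTFPart_stfPart (hG.posDef _ hq) T).contract_eq (hG.eta_null α hq)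

/-! ### The field `η` is null and geodesic up to scale -/

lemma sum_christoffel_eta_of_ne (α : ℝ) {q : ℝ × ℝ} (hq : q ∈ meridianDomain U α) (hne : q.2 ≠ 0)
    (k : Fin 3) :
    ∑ i, ∑ j, (christoffel G k i j (meridian α q) : ℂ) * (eta α i * eta α j) =
      2 * (∑ i, eta α i * ((pderiv i κ (meridian α q) : ℝ) : ℂ)) * eta α k := by
  have hρ : rho (meridian α q) ≠ 0 := rho_meridian_ne_zero hne
  have hrho : Continuous rho := by
    unfold rho
    fun_prop
  have hβ : DifferentiableAt ℝ β (meridian α q) :=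
    (hG.β_smooth.contDiffAt (hG.isOpen.mem_nhds hq)).differentiableAt (by simp)
  have hB : DifferentiableAt ℝ (fun y => (Real.exp (-2 * β y) - 1) / rho y ^ 2) (meridian α q) := by
    have hρ2 : DifferentiableAt ℝ (fun y => rho y ^ 2) (meridian α q) := by
      simp only [rho_sq]
      fun_prop
    simp only [div_eq_mul_inv]
    exact ((hβ.const_mul _).exp.sub_const _).mul (hρ2.inv (pow_ne_zero 2 hρ))
  refine sum_christoffel_eq_of_eventuallyEq_exp_smul (hG.posDef _ hq).det_pos.ne'.isUnit
    (hG.differentiableAt_κ hq) hB transpose_rotGenerator ?_ ?_ ?_ k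
  · filter_upwards [hG.isOpen.mem_nhds hq, hrho.continuousAt.eventually_ne hρ] with y hy hρy
    exact hG.eq_of_rho_ne_zero hy hρy
  · exact sum_eta_mul_eta α
  · simp only [rotGenerator_mulVec_meridian, Pi.smul_apply, smul_eq_mul, Complex.ofReal_mul,
      mul_assoc, ← Finset.mul_sum, sum_phiHat_mul_eta, mul_zero]

lemma sum_christoffel_eta (α : ℝ) {q : ℝ × ℝ} (hq : q ∈ meridianDomain U α) (k : Fin 3) :
    ∑ i, ∑ j, (christoffel G k i j (meridian α q) : ℂ) * (eta α i * eta α j) =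
      2 * (∑ i, eta α i * ((pderiv i κ (meridian α q) : ℝ) : ℂ)) * eta α k := by
  have hΓ (i j : Fin 3) : ContinuousOn (christoffel G k i j) U := fun x hx =>
    (contDiffAt_christoffel (fun i j => (hG.smooth i j).contDiffAt (hG.isOpen.mem_nhds hx))
      (hG.posDef x hx).det_pos.ne'.isUnit k i j).continuousAt.continuousWithinAt
  have hκ (i : Fin 3) : ContinuousOn (pderiv i κ) U := fun x hx =>
    (contDiffAt_pderiv (hG.κ_smooth.contDiffAt (hG.isOpen.mem_nhds hx))
      i).continuousAt.continuousWithinAt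
  refine eqOn_meridianDomain_of_ne hG.isOpen
    (F := fun q => ∑ i, ∑ j,
      (christoffel G k i j (meridian α q) : ℂ) * (eta α i * eta α j))
    (H := fun q => 2 * (∑ i, eta α i * ((pderiv i κ (meridian α q) : ℝ) : ℂ)) * eta α k)
    ?_ ?_ (fun q hq hne => hG.sum_christoffel_eta_of_ne α hq hne k) hq
  · have hΓ' (i j : Fin 3) := continuousOn_comp_meridian (α := α) (hΓ i j)
    fun_prop
  · have hκ' (i : Fin 3) := continuousOn_comp_meridian (α := α) (hκ i)
    fun_prop

end IsAxisymmetricMetric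

section Rotation

open scoped Matrix

variable (γ α : ℝ)

lemma transpose_rot_mul_rot : (rot γ)ᵀ * rot γ = 1 := by
  have hγ := Real.sin_sq_add_cos_sq γ
  ext i j
  fin_cases i <;> fin_cases j <;>
    simp [rot, Matrix.mul_apply, Fin.sum_univ_three] <;> linarith

lemma isUnit_det_rot : IsUnit (rot γ).det :=
  Matrix.isUnit_det_of_left_inverse (transpose_rot_mul_rot γ)

lemma rot_mulVec_meridian (q : ℝ × ℝ) : rot γ *ᵥ meridian α q = meridian (α + γ) q := by
  funext i
  fin_cases i <;>
    simp [rot, meridian, Matrix.mulVec, dotProduct, Fin.sum_univ_three, Real.cos_add,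
      Real.sin_add] <;> ring

lemma rot_mulVec_phiHat : rot γ *ᵥ phiHat α = phiHat (α + γ) := by
  funext i
  fin_cases i <;>
    simp [rot, phiHat, Matrix.mulVec, dotProduct, Fin.sum_univ_three, Real.cos_add,
      Real.sin_add] <;> ring

lemma transpose_rot_mulVec_phiHat : (rot γ)ᵀ *ᵥ phiHat (α + γ) = phiHat α := by
  rw [← rot_mulVec_phiHat, Matrix.mulVec_mulVec, transpose_rot_mul_rot, Matrix.one_mulVec]

lemma rot_map_mulVec_eta : (rot α).map Complex.ofRealHom *ᵥ eta 0 = eta α := by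
  funext i
  fin_cases i <;> simp [rot, eta, Matrix.mulVec, dotProduct, Fin.sum_univ_three] <;> ring

lemma rotST_mulVec_cons (x : Fin 3 → ℝ) :
    rotST γ *ᵥ Fin.cons 0 x = (Fin.cons 0 (rot γ *ᵥ x) : Fin 4 → ℝ) := by
  funext i
  fin_cases i <;> simp [rotST, rot, Matrix.mulVec, dotProduct, Fin.sum_univ_succ]

end Rotation

section STF

variable {ι : Type} [Fintype ι] [DecidableEq ι] {G : (ι → ℝ) → Matrix ι ι ℝ} {φ : (ι → ℝ) → ℂ}
  {x : ι → ℝ} (hG : (G x).PosDef)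

include hG

lemma isSymmetric_multipoleTensor : (n : ℕ) → IsSymmetric (multipoleTensor G φ n x)
  | 0 => fun _ _ => rfl
  | 1 => (isSTFPart_stfPart hG _).1
  | _ + 2 => (isSTFPart_stfPart hG _).1

lemma isTraceFree_multipoleTensor : (n : ℕ) → IsTraceFree (G x) (multipoleTensor G φ n x)
  | 0 => fun a => a.elim0
  | 1 => (isSTFPart_stfPart hG _).2.1
  | _ + 2 => (isSTFPart_stfPart hG _).2.1

end STF

section Contract

open scoped Matrix

lemma contract_mul_tail_tail {n : ℕ} (v : Fin 3 → ℂ) (R : Matrix (Fin 3) (Fin 3) ℂ)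
    (S : Tensor (Fin 3) ℂ n) :
    contract v (fun I : Fin (n + 2) → Fin 3 => R (I 0) (I 1) * S (Fin.tail (Fin.tail I))) =
      (v ⬝ᵥ R *ᵥ v) * contract v S := by
  rw [contract_succ, contract_succ, ← contract_smul]
  congr 1
  funext I
  simp only [contractFirst_apply, Fin.cons_zero, Fin.tail_cons, Pi.smul_apply, smul_eq_mul,
    dotProduct, Matrix.mulVec, Finset.mul_sum, Finset.sum_mul]
  rw [Finset.sum_comm]
  refine Finset.sum_congr rfl fun i _ => Finset.sum_congr rfl fun j _ => ?_
  rw [show (Fin.cons i (Fin.cons j I) : Fin (n + 2) → Fin 3) 1 = j from rfl]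
  ring

lemma contract_prod_dZ (α : ℝ) (n : ℕ) :
    contract (eta α) (fun I : Fin n → Fin 3 => ∏ k, (dZ (I k) : ℂ)) = 1 := by
  have hdZ : ∑ i, eta α i * (dZ i : ℂ) = 1 := by simp [eta, dZ, Fin.sum_univ_three]
  simp only [contract, ← Finset.prod_mul_distrib]
  rw [← Fintype.sum_pow fun i => eta α i * (dZ i : ℂ), hdZ, one_pow]

end Contract

/-! ### The scalars `fₙ` of an axisymmetric metric -/

lemma multipoleTensor_add_two {ι : Type} [Fintype ι] [DecidableEq ι]
    (G : (ι → ℝ) → Matrix ι ι ℝ) (φ : (ι → ℝ) → ℂ) (n : ℕ) (x : ι → ℝ) :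
    multipoleTensor G φ (n + 2) x = stfPart (G x) (covDeriv G (multipoleTensor G φ (n + 1)) x -
      (((n : ℂ) + 1) * (2 * n + 1) / 2) • fun I : Fin (n + 2) → ι =>
        (ricci G x (I 0) (I 1) : ℂ) * multipoleTensor G φ n x (Fin.tail (Fin.tail I))) := by
  rw [multipoleTensor]
  refine congrArg (stfPart (G x)) (funext fun I => ?_)
  simp only [Pi.sub_apply, Pi.smul_apply, smul_eq_mul, ← mul_assoc]

/-- The scalar `fₙ = η^{a₁} ⋯ η^{aₙ} P_{a₁…aₙ}` of the metric `G` and the potential `φ`, as a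
function of `(z̃, ρ̃)` on the meridian plane at angle `α`. -/
noncomputable def multipoleScalar (G : (Fin 3 → ℝ) → Matrix (Fin 3) (Fin 3) ℝ)
    (φ : (Fin 3 → ℝ) → ℂ) (α : ℝ) (n : ℕ) (q : ℝ × ℝ) : ℂ :=
  contract (eta α) (multipoleTensor G φ n (meridian α q))

/-- `η^a η^b R_{ab}` for the Ricci tensor of `G`, on the meridian plane at angle `α`. -/
noncomputable def etaRicci (G : (Fin 3 → ℝ) → Matrix (Fin 3) (Fin 3) ℝ) (α : ℝ) (q : ℝ × ℝ) : ℂ :=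
  contract (eta α) (n := 2) fun I => (ricci G (meridian α q) (I 0) (I 1) : ℂ)

open scoped Matrix in
lemma etaRicci_eq_dotProduct (G : (Fin 3 → ℝ) → Matrix (Fin 3) (Fin 3) ℝ) (α : ℝ) (q : ℝ × ℝ) :
    etaRicci G α q =
      eta α ⬝ᵥ (Matrix.of (ricci G (meridian α q))).map Complex.ofRealHom *ᵥ eta α := by
  have hR := contract_mul_tail_tail (n := 0) (eta α)
    ((Matrix.of (ricci G (meridian α q))).map Complex.ofRealHom) fun _ => 1
  simp only [contract_zero _ _ Fin.elim0, mul_one] at hR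
  exact hR

lemma contract_ricci_mul_tail_tail (G : (Fin 3 → ℝ) → Matrix (Fin 3) (Fin 3) ℝ) (α : ℝ)
    (q : ℝ × ℝ) {n : ℕ} (S : Tensor (Fin 3) ℂ n) :
    contract (eta α) (fun I : Fin (n + 2) → Fin 3 =>
      (ricci G (meridian α q) (I 0) (I 1) : ℂ) * S (Fin.tail (Fin.tail I))) =
      etaRicci G α q * contract (eta α) S := by
  rw [etaRicci_eq_dotProduct, ← contract_mul_tail_tail]
  rfl

namespace IsAxisymmetricMetric

open scoped Matrix

variable {U : Set (Fin 3 → ℝ)} {G : (Fin 3 → ℝ) → Matrix (Fin 3) (Fin 3) ℝ}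
  {κ β : (Fin 3 → ℝ) → ℝ} (hG : IsAxisymmetricMetric U G κ β)

include hG

lemma contDiffOn_multipoleTensor {φ : (Fin 3 → ℝ) → ℂ} (hφ : ContDiffOn ℝ ∞ φ U) (n : ℕ)
    (I : Fin n → Fin 3) : ContDiffOn ℝ ∞ (fun x => multipoleTensor G φ n x I) U := fun _ hx =>
  have hU := hG.isOpen.mem_nhds hx
  (contDiffAt_multipoleTensor (fun i j => (hG.smooth i j).contDiffAt hU)
    (Filter.eventually_of_mem hU hG.posDef) (hφ.contDiffAt hU) n I).contDiffWithinAt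

theorem contDiffOn_multipoleScalar {φ : (Fin 3 → ℝ) → ℂ} (hφ : ContDiffOn ℝ ∞ φ U) (α : ℝ)
    (n : ℕ) : ContDiffOn ℝ ∞ (multipoleScalar G φ α n) (meridianDomain U α) :=
  ContDiffOn.sum fun I _ => contDiffOn_const.mul
    ((hG.contDiffOn_multipoleTensor hφ n I).comp (contDiff_meridian α).contDiffOn mapsTo_meridian)

lemma eq_transpose_rot_mul_mul_rot (γ : ℝ) {x : Fin 3 → ℝ} (hx : x ∈ U) :
    G x = (rot γ)ᵀ * G (rot γ *ᵥ x) * rot γ := by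
  have hκ := hG.κ_inv γ x hx
  have hβ := hG.β_inv γ x hx
  have hγx := hG.domain γ x hx
  obtain ⟨α, q, rfl⟩ := exists_meridian_eq x
  rw [rot_mulVec_meridian] at hκ hβ hγx ⊢
  have hphi : (rot γ)ᵀ * Matrix.vecMulVec (phiHat (α + γ)) (phiHat (α + γ)) * rot γ =
      Matrix.vecMulVec (phiHat α) (phiHat α) := by
    rw [Matrix.mul_vecMulVec, Matrix.vecMulVec_mul, ← Matrix.mulVec_transpose,
      transpose_rot_mulVec_phiHat]
  rw [hG.eq_meridian α hx, hG.eq_meridian (α + γ) hγx, hκ, hβ]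
  simp only [Matrix.mul_smul, Matrix.smul_mul, mul_add, add_mul, mul_one, transpose_rot_mul_rot,
    hphi]

lemma meridianDomain_eq (α : ℝ) : meridianDomain U α = meridianDomain U 0 := by
  ext q
  constructor
  · intro hq
    have hmem := hG.domain (-α) _ hq
    rwa [rot_mulVec_meridian, add_neg_cancel] at hmem
  · intro hq
    have hmem := hG.domain α _ hq
    rwa [rot_mulVec_meridian, zero_add] at hmem

lemma etaRicci_eq (α : ℝ) {q : ℝ × ℝ} (hq : q ∈ meridianDomain U 0) :
    etaRicci G α q = etaRicci G 0 q := by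
  have hricci := ricci_eq_of_isometry hG.isOpen hG.smooth hG.posDef (isUnit_det_rot α)
    (hG.domain α) (fun y hy => hG.eq_transpose_rot_mul_mul_rot α hy) hq
  rw [rot_mulVec_meridian, zero_add] at hricci
  have hcomplex : (Matrix.of (ricci G (meridian 0 q))).map Complex.ofRealHom =
      ((rot α).map Complex.ofRealHom)ᵀ *
        (Matrix.of (ricci G (meridian α q))).map Complex.ofRealHom *
          (rot α).map Complex.ofRealHom := by
    rw [hricci, Matrix.map_mul, Matrix.map_mul, Matrix.transpose_map]
  rw [etaRicci_eq_dotProduct G α, etaRicci_eq_dotProduct G 0, hcomplex, ← Matrix.mulVec_mulVec,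
    ← Matrix.mulVec_mulVec, Matrix.dotProduct_mulVec (eta 0), Matrix.vecMul_transpose,
    rot_map_mulVec_eta]

lemma contract_covDeriv_multipoleTensor {φ : (Fin 3 → ℝ) → ℂ} (hφ : ContDiffOn ℝ ∞ φ U) (α : ℝ)
    (n : ℕ) {q : ℝ × ℝ} (hq : q ∈ meridianDomain U α) :
    contract (eta α) (covDeriv G (multipoleTensor G φ n) (meridian α q)) =
      etaD (multipoleScalar G φ α n) q -
        2 * n * multipoleScalar G φ α n q * etaD (fun q' => (κ (meridian α q') : ℂ)) q := by
  have hP (I : Fin n → Fin 3) :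
      DifferentiableAt ℝ (fun y => multipoleTensor G φ n y I) (meridian α q) :=
    ((hG.contDiffOn_multipoleTensor hφ n I).contDiffAt
      (hG.isOpen.mem_nhds hq)).differentiableAt (by simp)
  have hcontract :
      DifferentiableAt ℝ (fun y => contract (eta α) (multipoleTensor G φ n y)) (meridian α q) :=
    DifferentiableAt.fun_sum fun I _ => (hP I).const_mul _
  have hκ := hG.differentiableAt_κ hq
  have hκ' : DifferentiableAt ℝ (fun y => (κ y : ℂ)) (meridian α q) :=
    Complex.ofRealCLM.differentiableAt.comp _ hκ
  rw [contract_covDeriv hP (hG.sum_christoffel_eta α hq), etaD_comp_meridian hκ',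
    ← etaD_comp_meridian hcontract]
  simp only [pderiv_ofReal hκ]
  change etaD (multipoleScalar G φ α n) q - n * _ * multipoleScalar G φ α n q = _
  ring

theorem multipoleScalar_succ {φ : (Fin 3 → ℝ) → ℂ} (hφ : ContDiffOn ℝ ∞ φ U) (α : ℝ) (n : ℕ)
    {q : ℝ × ℝ} (hq : q ∈ meridianDomain U α) :
    multipoleScalar G φ α (n + 1) q = etaD (multipoleScalar G φ α n) q -
      2 * n * multipoleScalar G φ α n q * etaD (fun q' => (κ (meridian α q') : ℂ)) q -
      n * (2 * n - 1) / 2 * etaRicci G α q * multipoleScalar G φ α (n - 1) q := by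
  cases n with
  | zero =>
    have hf : multipoleScalar G φ α 1 q =
        contract (eta α) (covDeriv G (multipoleTensor G φ 0) (meridian α q)) :=
      hG.contract_stfPart α hq _
    rw [hf, hG.contract_covDeriv_multipoleTensor hφ α 0 hq, Nat.cast_zero]
    ring
  | succ n =>
    rw [multipoleScalar, multipoleTensor_add_two, hG.contract_stfPart α hq, contract_sub,
      contract_smul, hG.contract_covDeriv_multipoleTensor hφ α (n + 1) hq,
      contract_ricci_mul_tail_tail, ← multipoleScalar, Nat.add_sub_cancel]
    push_cast
    ring

theorem multipoleScalar_eq {φ : (Fin 3 → ℝ) → ℂ} (hφ : ContDiffOn ℝ ∞ φ U)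
    (hφrot : ∀ α, ∀ x ∈ U, φ (rot α *ᵥ x) = φ x) (α : ℝ) (n : ℕ) :
    Set.EqOn (multipoleScalar G φ α n) (multipoleScalar G φ 0 n) (meridianDomain U 0) := by
  have hopen := isOpen_meridianDomain hG.isOpen 0
  have hκ : Set.EqOn (fun q => (κ (meridian α q) : ℂ)) (fun q => (κ (meridian 0 q) : ℂ))
      (meridianDomain U 0) := fun q hq => by
    have hκq := hG.κ_inv α (meridian 0 q) hq
    rw [rot_mulVec_meridian, zero_add] at hκq
    simp only [hκq]
  induction n using Nat.strong_induction_on with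
  | _ n ih =>
    intro q hq
    cases n with
    | zero =>
      have hφq := hφrot α (meridian 0 q) hq
      rw [rot_mulVec_meridian, zero_add] at hφq
      rwa [multipoleScalar, multipoleScalar, contract_zero _ _ Fin.elim0,
        contract_zero _ _ Fin.elim0]
    | succ n =>
      rw [hG.multipoleScalar_succ hφ α n (by rwa [hG.meridianDomain_eq]),
        hG.multipoleScalar_succ hφ 0 n hq, hG.etaRicci_eq α hq,
        etaD_congr hopen (ih n (by omega)) hq, etaD_congr hopen hκ hq, ih n (by omega) hq,
        ih (n - 1) (by omega) hq]

theorem multipoleTensor_zero_eq_smul_iff {φ : (Fin 3 → ℝ) → ℂ} (hφ : ContDiffOn ℝ ∞ φ U)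
    (hφrot : ∀ α, ∀ x ∈ U, φ (rot α *ᵥ x) = φ x) (h0 : 0 ∈ U) (α : ℝ) (n : ℕ) (m : ℂ) :
    multipoleTensor G φ n 0 =
        m • stfPart (G 0) (fun I : Fin n → Fin 3 => ∏ k, (dZ (I k) : ℂ)) ↔
      m = multipoleScalar G φ α n (0, 0) := by
  set Z : Tensor (Fin 3) ℂ n := fun I => ∏ k, (dZ (I k) : ℂ)
  have hZ (γ : ℝ) : contract (eta γ) (stfPart (G 0) Z) = 1 := by
    have hstf := hG.contract_stfPart γ (zero_mem_meridianDomain h0 γ) Z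
    rwa [meridian_zero, contract_prod_dZ] at hstf
  have hP (γ : ℝ) :
      contract (eta γ) (multipoleTensor G φ n 0) = multipoleScalar G φ α n (0, 0) := by
    have hzero := zero_mem_meridianDomain h0 0
    rw [hG.multipoleScalar_eq hφ hφrot α n hzero, ← hG.multipoleScalar_eq hφ hφrot γ n hzero,
      multipoleScalar, meridian_zero]
  constructor
  · intro hm
    rw [← hP 0, hm, contract_smul, hZ, mul_one]
  · rintro rfl
    have hpos := hG.posDef 0 h0
    have hstf := isSTFPart_stfPart hpos Z
    have hsymm : IsSymmetric
        (multipoleTensor G φ n 0 - multipoleScalar G φ α n (0, 0) • stfPart (G 0) Z) :=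
      (isSymmetric_multipoleTensor hpos n).sub (hstf.1.smul _)
    have hfree : IsTraceFree (Real.exp (2 * κ 0) • 1)
        (multipoleTensor G φ n 0 - multipoleScalar G φ α n (0, 0) • stfPart (G 0) Z) := by
      rw [← hG.apply_zero h0]
      exact (isTraceFree_multipoleTensor hpos n).sub (hstf.2.1.smul _)
    refine sub_eq_zero.1 (eq_zero_of_contract_eta hsymm
      (hfree.of_smul (Real.exp_pos _).ne' (by simp)) fun γ => ?_)
    rw [contract_sub, contract_smul, hZ, mul_one, hP, sub_self]

end IsAxisymmetricMetric

namespace IsAxisymmetric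

open scoped Matrix

variable {U : Set (Fin 3 → ℝ)} {M : StationarySpacetime (U \ {0})} {A : ConformalCompletion U M}
  {κ β : (Fin 3 → ℝ) → ℝ} (hA : IsAxisymmetric A κ β)

include hA

lemma isAxisymmetricMetric : IsAxisymmetricMetric U A.hT κ β where
  isOpen := A.isOpen
  domain := hA.domain
  smooth := A.hT_smooth
  posDef := A.hT_posDef
  κ_smooth := hA.κ_smooth
  κ_inv := hA.κ_inv
  β_smooth := hA.β_smooth
  β_inv := hA.β_inv
  form := hA.form

lemma rot_mulVec_mem (γ : ℝ) {x : Fin 3 → ℝ} (hx : x ∈ U \ {0}) : rot γ *ᵥ x ∈ U \ {0} := by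
  refine ⟨hA.domain γ x hx.1, fun hzero => hx.2 ?_⟩
  exact Matrix.eq_zero_of_mulVec_eq_zero (isUnit_det_rot γ).ne_zero hzero

lemma gAt_rot_apply (γ : ℝ) {x : Fin 3 → ℝ} (hx : x ∈ U \ {0}) {a b : Fin 4}
    (ha : a = 0 ∨ a = 3) (hb : b = 0 ∨ b = 3) : M.gAt (rot γ *ᵥ x) a b = M.gAt x a b := by
  have hg : (rotST γ)ᵀ * M.gAt (rot γ *ᵥ x) * rotST γ = M.gAt x := by
    rw [StationarySpacetime.gAt, ← rotST_mulVec_cons]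
    exact hA.metric γ (Fin.cons 0 x) hx
  rw [← hg]
  rcases ha with rfl | rfl <;> rcases hb with rfl | rfl <;>
    simp [rotST, Matrix.mul_apply, Fin.sum_univ_four]

lemma lam_rot (γ : ℝ) {x : Fin 3 → ℝ} (hx : x ∈ U \ {0}) : M.lam (rot γ *ᵥ x) = M.lam x := by
  simp [StationarySpacetime.lam, xi, hA.gAt_rot_apply γ hx (.inl rfl) (.inl rfl)]

lemma h_rot_apply_two_two (γ : ℝ) {x : Fin 3 → ℝ} (hx : x ∈ U \ {0}) :
    M.h (rot γ *ᵥ x) 2 2 = M.h x 2 2 := by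
  simp only [StationarySpacetime.h, Matrix.of_apply, hA.lam_rot γ hx, xi,
    Matrix.mulVec_single_one, Matrix.col_apply]
  rw [show (2 : Fin 3).succ = (3 : Fin 4) from rfl,
    hA.gAt_rot_apply γ hx (.inr rfl) (.inr rfl), hA.gAt_rot_apply γ hx (.inr rfl) (.inl rfl)]

lemma Ω_rot (γ : ℝ) {x : Fin 3 → ℝ} (hx : x ∈ U \ {0}) : A.Ω (rot γ *ᵥ x) = A.Ω x := by
  have hγx := hA.rot_mulVec_mem γ hx
  have hhT : A.hT x 2 2 = A.hT (rot γ *ᵥ x) 2 2 := by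
    rw [hA.isAxisymmetricMetric.eq_transpose_rot_mul_mul_rot γ hx.1]
    simp [rot, Matrix.mul_apply, Fin.sum_univ_three]
  have hpos : 0 < A.hT x 2 2 := (A.hT_posDef x hx.1).diag_pos
  rw [A.hT_eq x hx, Matrix.smul_apply, smul_eq_mul] at hhT hpos
  rw [A.hT_eq _ hγx, Matrix.smul_apply, smul_eq_mul, hA.h_rot_apply_two_two γ hx] at hhT
  have hsq := mul_right_cancel₀ (right_ne_zero_of_mul hpos.ne') hhT
  exact ((sq_eq_sq₀ (A.Ω_pos _ hx).le (A.Ω_pos _ hγx).le).1 hsq).symm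

lemma phiT_rot (γ : ℝ) {x : Fin 3 → ℝ} (hx : x ∈ U) : A.phiT (rot γ *ᵥ x) = A.phiT x := by
  rcases eq_or_ne x 0 with rfl | hne
  · rw [Matrix.mulVec_zero]
  · have hxV : x ∈ U \ {0} := ⟨hx, hne⟩
    rw [A.phiT_eq _ (hA.rot_mulVec_mem γ hxV), A.phiT_eq _ hxV, hA.Ω_rot γ hxV,
      StationarySpacetime.potential, StationarySpacetime.potential, hA.lam_rot γ hxV,
      hA.omega γ x hxV]

end IsAxisymmetric

end GerochHansen

open GerochHansen in
theorem mainTheorem1_general {U : Set (Fin 3 → ℝ)} {G : (Fin 3 → ℝ) → Matrix (Fin 3) (Fin 3) ℝ}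
    {κ β : (Fin 3 → ℝ) → ℝ} (hG : IsAxisymmetricMetric U G κ β) (h0 : 0 ∈ U)
    {φ : (Fin 3 → ℝ) → ℂ} (hφ : ContDiffOn ℝ ∞ φ U)
    (hφrot : ∀ α, ∀ x ∈ U, φ ((rot α).mulVec x) = φ x) :
    (∀ (α : ℝ) (n : ℕ), ContDiffOn ℝ ∞ (multipoleScalar G φ α n) (meridianDomain U α)) ∧
    (∀ (α : ℝ) (n : ℕ), ∀ q ∈ meridianDomain U α,
      multipoleScalar G φ α n q = multipoleScalar G φ 0 n q) ∧
    (∀ (α : ℝ) (n : ℕ), 1 ≤ n → ∀ q ∈ meridianDomain U α,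
      multipoleScalar G φ α n q =
        etaD (multipoleScalar G φ α (n - 1)) q
        - 2 * ((n : ℂ) - 1) * multipoleScalar G φ α (n - 1) q *
            etaD (fun q' => (κ (meridian α q') : ℂ)) q
        - ((n : ℂ) - 1) * (2 * (n : ℂ) - 3) / 2 * etaRicci G α q *
            multipoleScalar G φ α (n - 2) q) ∧
    (∀ (α : ℝ) (n : ℕ) (m : ℂ),
      multipoleTensor G φ n 0 =
          m • stfPart (G 0) (fun I : Fin n → Fin 3 => ∏ k, (dZ (I k) : ℂ)) ↔
        m = multipoleScalar G φ α n (0, 0)) := by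
  refine ⟨hG.contDiffOn_multipoleScalar hφ, fun α n q hq => ?_, fun α n hn q hq => ?_,
    hG.multipoleTensor_zero_eq_smul_iff hφ hφrot h0⟩
  · rw [hG.meridianDomain_eq] at hq
    exact hG.multipoleScalar_eq hφ hφrot α n hq
  · obtain ⟨n, rfl⟩ := Nat.exists_eq_add_of_le' hn
    rw [hG.multipoleScalar_succ hφ α n hq, Nat.add_sub_cancel, show n + 1 - 2 = n - 1 by omega]
    push_cast
    ring

theorem mainTheorem1 {U : Set (Fin 3 → ℝ)} {M : GerochHansen.StationarySpacetime (U \ {0})}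
    (A : GerochHansen.ConformalCompletion U M) (κ β : (Fin 3 → ℝ) → ℝ)
    (hA : GerochHansen.IsAxisymmetric A κ β) :
    -- the scalars are smooth functions of `(z̃, ρ̃)`, the same on all meridian planes
    (∀ (α : ℝ) (n : ℕ),
      ContDiffOn ℝ (⊤ : ℕ∞) (A.f α n) (GerochHansen.meridianDomain U α)) ∧
    (∀ (α : ℝ) (n : ℕ), ∀ q ∈ GerochHansen.meridianDomain U α, A.f α n q = A.f 0 n q) ∧
    -- the recursion; for `n = 1` the last coefficient is zero
    (∀ (α : ℝ) (n : ℕ), 1 ≤ n → ∀ q ∈ GerochHansen.meridianDomain U α,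
      A.f α n q =
        GerochHansen.etaD (A.f α (n - 1)) q
        - 2 * ((n : ℂ) - 1) * A.f α (n - 1) q *
            GerochHansen.etaD (fun q' => (κ (GerochHansen.meridian α q') : ℂ)) q
        - ((n : ℂ) - 1) * (2 * (n : ℂ) - 3) / 2 * A.etaRicci α q * A.f α (n - 2) q) ∧
    -- the moment `mₙ` exists, is unique, and equals `fₙ(Λ)`
    (∀ (α : ℝ) (n : ℕ) (m : ℂ), A.IsMoment n m ↔ m = A.f α n (0, 0)) :=
  mainTheorem1_general hA.isAxisymmetricMetric A.mem_zero A.phiT_smooth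
    fun α _ => hA.phiT_rot α
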